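/- Graphs are finite, simple and undirected, and classes of graphs are closed under isomorphism. For graphs $F$ and $G$, let $\hom(F,G)$ denote the number of homomorphisms from $F$ to $G$, that is, of maps $V(F) \to V(G)$ that send every edge of $F$ to an edge of $G$. Let $\mathcal{F}$ and $\mathcal{G}$ be classes of graphs such that membership in $\mathcal{G}$ is decidable, $\mathcal{G}$ is closed under taking induced subgraphs (including the graph without vertices) and under disjoint unions, and every $F \in \mathcal{F}$ is connected (in particular non-empty). Then the following parameterised problem is fixed-parameter tractable. Input: a graph $F \in \mathcal{F}$, given by its adjacency matrix, and a number $h \in \mathbb{N} = \{0,1,2,\dots\}$, given in binary. Parameter: $|V(F)|$. Question: does there exist a graph $G \in \mathcal{G}$ with $\hom(F,G) = h$? That is, there are a deterministic (multi-stack) Turing machine, a computable function $f \colon \mathbb{N} \to \mathbb{N}$ and a polynomial $p$ such that, for every $F \in \mathcal{F}$ and $h \in \mathbb{N}$, the machine, started on the encoding of $(F,h)$, halts after at most $f(|V(F)|) \cdot p(n)$ steps, where $n$ is the length of this encoding, and answers the question correctly. Nothing is required of the machine on inputs $(F,h)$ with $F \notin \mathcal{F}$. -/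

import Mathlib

/-- A finite simple graph, given with the vertex set `{0, …, order - 1}`.
Every finite graph is isomorphic to one of these. -/
structure FinGraph where
  order : ℕ
  graph : SimpleGraph (Fin order)

namespace FinGraph

/-- The number of homomorphisms from `F` to `G`. -/
noncomputable def homCount (F G : FinGraph) : ℕ :=
  Nat.card (F.graph →g G.graph)

open Classical in
/-- A graph as a bit string: its adjacency matrix, row by row. -/
noncomputable def encode (G : FinGraph) : List Bool :=
  (List.finRange G.order ×ˢ List.finRange G.order).map
    fun p => decide (G.graph.Adj p.1 p.2)

theorem encode_injective : Function.Injective encode := by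
  rintro ⟨m, G⟩ ⟨n, H⟩ h
  have hl := congrArg List.length h
  simp only [encode, List.length_map, List.length_product, List.length_finRange] at hl
  obtain rfl : m = n := Nat.mul_self_inj.mp hl
  have hG : G = H := by
    ext i j
    simp only [encode, List.map_inj_left] at h
    have := h (i, j) (by simp)
    simpa using this
  rw [hG]

/-- An instance `(F, h)` as a string: the adjacency matrix of `F` followed by the binary
representation of `h`, the two parts being written in two disjoint copies of the alphabet `Bool`. -/
noncomputable def encodeWithNumber (x : FinGraph × ℕ) : List (Bool ⊕ Bool) :=
  x.1.encode.map Sum.inl ++ (Computability.encodeNat x.2).map Sum.inr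

theorem encodeWithNumber_injective : Function.Injective encodeWithNumber := by
  rintro ⟨F, a⟩ ⟨G, b⟩ h
  have hL : ∀ l m : List Bool, (l.map Sum.inl ++ m.map Sum.inr : List (Bool ⊕ Bool)).filterMap
      Sum.getLeft? = l := by
    simp [List.filterMap_map, Function.comp_def]
  have hR : ∀ l m : List Bool, (l.map Sum.inl ++ m.map Sum.inr : List (Bool ⊕ Bool)).filterMap
      Sum.getRight? = m := by
    simp [List.filterMap_map, Function.comp_def]
  have hl := congrArg (List.filterMap Sum.getLeft?) h
  have hr := congrArg (List.filterMap Sum.getRight?) h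
  rw [encodeWithNumber, encodeWithNumber, hL, hL] at hl
  rw [encodeWithNumber, encodeWithNumber, hR, hR] at hr
  have hab : a = b := by
    simpa using congrArg Computability.decodeNat hr
  exact Prod.ext (encode_injective hl) hab

/-- Membership in the graph class `𝒢` is decidable: the set of the adjacency matrices of its
members is a decidable set of bit strings. -/
def DecidableMembership (𝒢 : Set FinGraph) : Prop :=
  ComputablePred fun w : List Bool => ∃ G ∈ 𝒢, G.encode = w

/-- `𝒢` contains every graph that is isomorphic to an induced subgraph of a member of `𝒢`.
In particular `𝒢` is closed under isomorphism. -/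
def ClosedUnderInducedSubgraphs (𝒢 : Set FinGraph) : Prop :=
  ∀ G ∈ 𝒢, ∀ H : FinGraph, Nonempty (H.graph ↪g G.graph) → H ∈ 𝒢

/-- `𝒢` contains every graph that is isomorphic to the disjoint union of two members of `𝒢`. -/
def ClosedUnderDisjointUnions (𝒢 : Set FinGraph) : Prop :=
  ∀ G ∈ 𝒢, ∀ H ∈ 𝒢, ∀ K : FinGraph, Nonempty (K.graph ≃g G.graph ⊕g H.graph) → K ∈ 𝒢

end FinGraph

/-- A parameterized decision problem. Every instance is presented to a machine as a string over
the alphabet `Sym`. -/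
structure ParamProblem where
  Instance : Type
  Sym : Type
  encode : Instance → List Sym
  param : Instance → ℕ
  Yes : Instance → Prop

/-- Fixed-parameter tractability: there are a Turing machine (with finitely many stacks in place
of tapes, all over finite alphabets), a computable function `f` and a polynomial `p` such that
on every instance `x`, written as a string of length `n`, the machine halts after at most
`f (param x) * p n` steps and outputs the single bit that says whether `x` is a yes-instance. -/
def ParamProblem.InFPT (P : ParamProblem) : Prop :=
  ∃ (M : Turing.TM2ComputableAux P.Sym Bool) (f : ℕ → ℕ) (p : Polynomial ℕ),
    (∀ k, Finite (M.tm.Γ k)) ∧ Computable f ∧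
    ∀ x : P.Instance, ∃ b : Bool, (b = true ↔ P.Yes x) ∧
      Nonempty (Turing.TM2OutputsInTime M.tm
        ((P.encode x).map M.inputAlphabet.symm)
        (some ([b].map M.outputAlphabet.symm))
        (f (P.param x) * p.eval (P.encode x).length))

/-- The problem whose input is a graph `F ∈ 𝓕` and a natural number `h` in binary, whose
parameter is the number of vertices of `F`, and whose question is whether some `G ∈ 𝒢` has
exactly `h` homomorphisms from `F`. -/
noncomputable def pSingleHomRec (𝓕 𝒢 : Set FinGraph) : ParamProblem where
  Instance := {x : FinGraph × ℕ // x.1 ∈ 𝓕}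
  Sym := Bool ⊕ Bool
  encode x := FinGraph.encodeWithNumber x.1
  param x := x.1.1.order
  Yes x := ∃ G ∈ 𝒢, FinGraph.homCount x.1.1 G = x.1.2

/-! Fix a connected `F` of order `k` and let `H` be the set of numbers hom(F,G) with G in the class.
A homomorphism from a connected graph into a disjoint union lands in one summand, so `H`, if
non-empty, is a submonoid of ℕ (`homSubmonoid`). Sorting homomorphisms by their image and inverting
over subsets shows that every element of `H` is an integer combination of counts into induced
subgraphs with at most `k` vertices (`card_hom_mem_of_forall_induce`). These counts again lie in `H`
and are at most `k ^ k`. Hence the subgroup `L` of ℤ generated by `H` has generators in `H` bounded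
by `k ^ k`, and beyond a threshold depending only on `k` the sets `H` and `L ∩ ℕ` agree
(`AddSubmonoid.mem_of_mem_intSpan`). There `H` is periodic with period `(k ^ k)!`
(`add_period_mem_homValues_iff`).

So `h` may be replaced by a representative bounded in terms of `k`. For that number, membership in
`H` is decided by brute force: if hom(F,G) = h, the images of all homomorphisms together have at
most `h * k` vertices and induce a member of the class with the same count
(`exists_computable_homValues`).

For the running time, the input is read once by a fold with a computable transition function `δ`,
whose states are bounded by a computable function of `k` because `h` is kept only in reduced form
(`exists_transition`). A fixed machine evaluates `δ` once per symbol, in a number of steps that is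
itself a computable function of symbol and state (`exists_evaluator`). The cost per symbol is thus
computably bounded in `k`, and the total time is linear in the input length with this bound as
factor. -/

/-! ### Large elements of numerical monoids -/

/-- A natural number in the `ℤ`-span of finitely many generators `x ≤ B` of a numerical monoid
belongs to the monoid, provided that it is at least `(B + 1) * B * B`. -/
theorem AddSubmonoid.mem_of_mem_intSpan (H : AddSubmonoid ℕ) {B : ℕ} {A : Finset ℕ}
    (hAH : ∀ x ∈ A, x ∈ H) (hAB : ∀ x ∈ A, x ≤ B) {a : ℕ} (ha : a ∈ A) (ha0 : 0 < a) {h : ℕ}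
    (hspan : (h : ℤ) ∈ Submodule.span ℤ ((fun x : ℕ => (x : ℤ)) '' (A : Set ℕ)))
    (hh : (B + 1) * B * B ≤ h) : h ∈ H := by
  obtain ⟨c, hc⟩ : ∃ c : ℕ → ℤ, ∑ x ∈ A, c x * (x : ℤ) = h := by
    obtain ⟨c, hc⟩ := (Submodule.mem_span_image_finset_iff_exists_fun ℤ).1 hspan
    refine ⟨fun x => if hx : x ∈ A then c ⟨x, hx⟩ else 0, ?_⟩
    rw [← hc, ← Finset.sum_coe_sort]
    exact Finset.sum_congr rfl fun x _ => by simp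
  have ha0' : (0 : ℤ) < a := by exact_mod_cast ha0
  -- Reducing the coefficients modulo `a` makes them natural numbers at most `B` and changes the sum
  -- by a multiple of `a`. As `s` is at most the threshold, the difference `h - s` is a natural
  -- multiple of `a`.
  set n : ℕ → ℕ := fun x => (c x % a).toNat with hn
  have hn' : ∀ x, (n x : ℤ) = c x % a := fun x =>
    Int.toNat_of_nonneg (Int.emod_nonneg _ ha0'.ne')
  have hnB : ∀ x, n x ≤ B := by
    intro x
    have h1 := Int.emod_lt_of_pos (c x) ha0'
    have h2 := hAB a ha
    have h3 := hn' x
    omega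
  set s : ℕ := ∑ x ∈ A, n x * x with hs
  have hsH : s ∈ H := H.sum_mem fun x hx => by
    simpa using H.nsmul_mem (hAH x hx) (n x)
  have hcard : A.card ≤ B + 1 := by
    have : A ⊆ Finset.range (B + 1) := fun x hx => by
      have := hAB x hx
      simp only [Finset.mem_range]; omega
    simpa using Finset.card_le_card this
  have hsle : s ≤ h := by
    refine le_trans ?_ hh
    calc s ≤ ∑ x ∈ A, B * B := Finset.sum_le_sum fun x hx => Nat.mul_le_mul (hnB x) (hAB x hx)
      _ = A.card * (B * B) := by simp
      _ ≤ (B + 1) * (B * B) := Nat.mul_le_mul_right _ hcard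
      _ = _ := by ring
  have hdvd : (a : ℤ) ∣ (h : ℤ) - s := by
    rw [← hc, hs]
    push_cast
    rw [← Finset.sum_sub_distrib]
    refine Finset.dvd_sum fun x _ => ?_
    rw [hn', ← sub_mul]
    exact Dvd.dvd.mul_right (Int.dvd_self_sub_emod) _
  have hdvd' : a ∣ h - s := by
    rw [← Nat.cast_sub hsle] at hdvd
    exact_mod_cast hdvd
  obtain ⟨t, ht⟩ := hdvd'
  have : h = s + t * a := by rw [mul_comm]; omega
  rw [this]
  exact H.add_mem hsH (by simpa using H.nsmul_mem (hAH a ha) t)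

/-! ### Homomorphism counts, disjoint unions and induced subgraphs -/

namespace SimpleGraph

variable {U V W : Type*}

/-- A homomorphism into a disjoint union with connected domain lands in one of the summands. -/
theorem Connected.hom_sum_range {F : SimpleGraph U} (hF : F.Connected) {G : SimpleGraph V}
    {H : SimpleGraph W} (f : F →g G ⊕g H) :
    (∃ g : F →g G, f = Embedding.sumInl.toHom.comp g) ∨
      ∃ g : F →g H, f = Embedding.sumInr.toHom.comp g := by
  obtain ⟨u⟩ := hF.nonempty
  -- Adjacent vertices of a sum lie on the same side, so the side is constant along walks.
  have key : ∀ v, (f v).isLeft = (f u).isLeft := by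
    intro v
    have hr : F.Reachable u v := hF.preconnected u v
    rw [SimpleGraph.reachable_iff_reflTransGen] at hr
    induction hr with
    | refl => rfl
    | tail _ hab ih =>
      rw [← ih]
      have := f.map_adj hab
      revert this
      generalize f _ = x
      generalize f _ = y
      rcases x with x | x <;> rcases y with y | y <;> simp
  rcases h : (f u).isLeft with _ | _
  · right
    have key' : ∀ v, ∃ w, f v = Sum.inr w := by
      intro v
      have := key v
      rw [h] at this
      rcases hv : f v with x | x
      · simp [hv] at this
      · exact ⟨x, rfl⟩
    choose g hg using key'
    refine ⟨⟨g, fun {a b} hab => ?_⟩, ?_⟩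
    · have := f.map_adj hab
      rwa [hg, hg, sum_adj_inr] at this
    · ext v
      exact hg v
  · left
    have key' : ∀ v, ∃ w, f v = Sum.inl w := by
      intro v
      have := key v
      rw [h] at this
      rcases hv : f v with x | x
      · exact ⟨x, rfl⟩
      · simp [hv] at this
    choose g hg using key'
    refine ⟨⟨g, fun {a b} hab => ?_⟩, ?_⟩
    · have := f.map_adj hab
      rwa [hg, hg, sum_adj_inl] at this
    · ext v
      exact hg v

/-- Connectedness gives surjectivity of the map from the sum type; non-emptiness of `F` keeps its
two cases apart. -/
theorem Connected.card_hom_sum [Finite U] [Finite V] [Finite W] {F : SimpleGraph U}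
    (hF : F.Connected) (G : SimpleGraph V) (H : SimpleGraph W) :
    Nat.card (F →g G ⊕g H) = Nat.card (F →g G) + Nat.card (F →g H) := by
  have hfin : Finite (F →g G) := Finite.of_injective _ DFunLike.coe_injective
  have hfin' : Finite (F →g H) := Finite.of_injective _ DFunLike.coe_injective
  rw [← Nat.card_sum]
  symm
  refine Nat.card_eq_of_bijective (fun x => Sum.elim
    (fun g => Embedding.sumInl.toHom.comp g) (fun g => Embedding.sumInr.toHom.comp g) x) ⟨?_, ?_⟩
  · obtain ⟨u⟩ := hF.nonempty
    rintro (g | g) (g' | g') h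
    · congr 1
      ext v
      have := congrArg (fun f : F →g G ⊕g H => f v) h
      simpa using this
    · have := congrArg (fun f : F →g G ⊕g H => f u) h
      simp at this
    · have := congrArg (fun f : F →g G ⊕g H => f u) h
      simp at this
    · congr 1
      ext v
      have := congrArg (fun f : F →g G ⊕g H => f v) h
      simpa using this
  · intro f
    rcases hF.hom_sum_range f with ⟨g, rfl⟩ | ⟨g, rfl⟩
    · exact ⟨Sum.inl g, rfl⟩
    · exact ⟨Sum.inr g, rfl⟩

/-- Homomorphisms into an induced subgraph are the homomorphisms with image in the given set. -/
def homInduceEquiv (F : SimpleGraph U) (G : SimpleGraph V) (s : Set V) :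
    (F →g G.induce s) ≃ {f : F →g G // ∀ u, f u ∈ s} where
  toFun g := ⟨(Embedding.induce s).toHom.comp g, fun u => (g u).2⟩
  invFun f := ⟨fun u => ⟨f.1 u, f.2 u⟩, fun {_ _} h => f.1.map_adj h⟩
  left_inv _ := rfl
  right_inv _ := rfl

open Classical in
/-- The number of homomorphisms into `G` is an integer combination of the numbers of homomorphisms
into induced subgraphs of `G` that are not larger than the domain. -/
theorem card_hom_mem_of_forall_induce [Finite U] [Finite V] (F : SimpleGraph U) (G : SimpleGraph V)
    (L : Submodule ℤ ℤ)
    (hL : ∀ s : Finset V, s.card ≤ Nat.card U →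
      (Nat.card (F →g G.induce (s : Set V)) : ℤ) ∈ L) :
    (Nat.card (F →g G) : ℤ) ∈ L := by
  have hfin : Finite (F →g G) := Finite.of_injective _ DFunLike.coe_injective
  have := Fintype.ofFinite U
  have := Fintype.ofFinite V
  have := Fintype.ofFinite (F →g G)
  let im : (F →g G) → Finset V := fun f => Finset.univ.image f
  -- The homomorphisms with image exactly `s`. Counts into induced subgraphs are sums of `e` over
  -- subsets; strong induction inverts this, and `e s` vanishes when `s` is larger than the domain.
  let e : Finset V → ℕ := fun s => (Finset.univ.filter fun f : F →g G => im f = s).card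
  have ht : ∀ s : Finset V, Nat.card (F →g G.induce (s : Set V)) = ∑ w ∈ s.powerset, e w := by
    intro s
    rw [Nat.card_congr (homInduceEquiv F G s), Nat.card_eq_fintype_card, Fintype.card_subtype,
      Finset.card_eq_sum_card_fiberwise (f := im) (t := s.powerset)]
    · refine Finset.sum_congr rfl fun w hw => ?_
      congr 1
      ext f
      simp only [Finset.mem_filter, Finset.mem_univ, true_and, and_iff_right_iff_imp]
      rintro rfl u
      exact Finset.mem_powerset.1 hw (Finset.mem_image_of_mem _ (Finset.mem_univ u))
    · intro f hf
      simp only [Finset.coe_filter, Finset.mem_univ, true_and, Set.mem_ofPred_eq] at hf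
      simp only [Finset.coe_powerset, Set.mem_preimage, Set.mem_powerset_iff]
      intro v hv
      obtain ⟨u, -, rfl⟩ := Finset.mem_image.1 (Finset.mem_coe.1 hv)
      exact hf u
  have he : ∀ s : Finset V, (e s : ℤ) ∈ L := by
    intro s
    induction s using Finset.strongInduction with
    | H s ih =>
      by_cases hs : s.card ≤ Nat.card U
      · have h1 := hL s hs
        rw [ht, ← Finset.add_sum_erase _ _ (Finset.mem_powerset_self s)] at h1
        push_cast at h1
        refine (L.add_mem_iff_left (L.sum_mem fun w hw => ?_)).1 h1
        rw [Finset.mem_erase, Finset.mem_powerset] at hw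
        exact ih w (Finset.ssubset_iff_subset_ne.2 ⟨hw.2, hw.1⟩)
      · have : e s = 0 := by
          rw [Finset.card_eq_zero, Finset.filter_eq_empty_iff]
          rintro f - rfl
          refine hs ?_
          rw [Nat.card_eq_fintype_card]
          exact Finset.card_image_le
        rw [this]
        exact L.zero_mem
  have : Nat.card (F →g G) = ∑ w : Finset V, e w := by
    rw [Nat.card_eq_fintype_card, ← Finset.card_univ,
      Finset.card_eq_sum_card_fiberwise (f := im) (t := Finset.univ)]
    intro f _
    simp
  rw [this]
  push_cast
  exact L.sum_mem fun w _ => he w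

open Classical in
/-- All homomorphisms into `G` map into an induced subgraph whose order is at most the number of
homomorphisms times the order of the domain. -/
theorem exists_card_hom_induce_eq [Finite U] [Finite V] (F : SimpleGraph U) (G : SimpleGraph V) :
    ∃ s : Finset V, s.card ≤ Nat.card (F →g G) * Nat.card U ∧
      Nat.card (F →g G.induce (s : Set V)) = Nat.card (F →g G) := by
  have hfin : Finite (F →g G) := Finite.of_injective _ DFunLike.coe_injective
  have := Fintype.ofFinite U
  have := Fintype.ofFinite (F →g G)
  refine ⟨Finset.univ.biUnion fun f : F →g G => Finset.univ.image f, ?_, ?_⟩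
  · rw [Nat.card_eq_fintype_card, Nat.card_eq_fintype_card, ← Finset.card_univ]
    exact Finset.card_biUnion_le_card_mul _ _ _ fun f _ => Finset.card_image_le
  · rw [Nat.card_congr (homInduceEquiv F G _)]
    refine Nat.card_congr (Equiv.subtypeUnivEquiv fun f u => ?_)
    simp only [Finset.coe_biUnion, Set.mem_iUnion]
    exact ⟨f, by simp⟩

end SimpleGraph

/-! ### Eventual periodicity of the set of homomorphism numbers -/

namespace FinGraph

theorem homCount_congr (F : FinGraph) {V : Type*} {H : SimpleGraph V} {G : FinGraph}
    (e : G.graph ≃g H) : F.homCount G = Nat.card (F.graph →g H) :=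
  Nat.card_congr (SimpleGraph.Iso.homCongr .refl e)

/-- The subgraph induced by a set of vertices, with its vertices renumbered. -/
noncomputable def induce (G : FinGraph) (s : Finset (Fin G.order)) : FinGraph :=
  ⟨s.card, (G.graph.induce (s : Set (Fin G.order))).overFin (by simp)⟩

noncomputable def induceIso (G : FinGraph) (s : Finset (Fin G.order)) :
    (G.induce s).graph ≃g G.graph.induce (s : Set (Fin G.order)) :=
  (SimpleGraph.overFinIso _ _).symm

theorem homCount_le (F G : FinGraph) : F.homCount G ≤ G.order ^ F.order := by
  have := Nat.card_le_card_of_injective (fun f : F.graph →g G.graph => (f : Fin _ → Fin _))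
    DFunLike.coe_injective
  simpa [homCount] using this

/-- The numbers of homomorphisms from `F` to the members of a graph class. -/
def homValues (F : FinGraph) (𝒢 : Set FinGraph) : Set ℕ :=
  {h | ∃ G ∈ 𝒢, F.homCount G = h}

variable {F : FinGraph} {𝒢 : Set FinGraph}

theorem ClosedUnderInducedSubgraphs.induce_mem (h : ClosedUnderInducedSubgraphs 𝒢) {G : FinGraph}
    (hG : G ∈ 𝒢) (s : Finset (Fin G.order)) : G.induce s ∈ 𝒢 :=
  h G hG _ ⟨(SimpleGraph.Embedding.induce _).comp (G.induceIso s).toEmbedding⟩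

/-- Restricting to the union of the images of all homomorphisms loses none of them. This makes the
search for a witness finite. -/
theorem exists_order_le_of_mem_homValues (hI : ClosedUnderInducedSubgraphs 𝒢) {h : ℕ}
    (hh : h ∈ F.homValues 𝒢) : ∃ G ∈ 𝒢, G.order ≤ h * F.order ∧ F.homCount G = h := by
  obtain ⟨G, hG, rfl⟩ := hh
  obtain ⟨s, hs, hcard⟩ := F.graph.exists_card_hom_induce_eq G.graph
  refine ⟨G.induce s, hI.induce_mem hG s, ?_, ?_⟩
  · simpa [homCount, induce] using hs
  · rw [homCount_congr F (G.induceIso s), hcard]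
    rfl

/-- The numbers of homomorphisms from a connected graph to the members of a nonempty class that
is closed under induced subgraphs and disjoint unions form a numerical monoid. -/
def homSubmonoid (hF : F.graph.Connected) (hI : ClosedUnderInducedSubgraphs 𝒢)
    (hU : ClosedUnderDisjointUnions 𝒢) (hne : 𝒢.Nonempty) : AddSubmonoid ℕ where
  carrier := F.homValues 𝒢
  zero_mem' := by
    obtain ⟨G, hG⟩ := hne
    -- The graph without vertices receives no homomorphism, since `F` has a vertex.
    refine ⟨G.induce ∅, hI.induce_mem hG _, ?_⟩
    rw [homCount_congr F (G.induceIso _)]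
    obtain ⟨u⟩ := hF.nonempty
    have : IsEmpty (F.graph →g G.graph.induce ((∅ : Finset (Fin G.order)) : Set _)) :=
      ⟨fun f => by simpa using (f u).2⟩
    exact Nat.card_of_isEmpty
  add_mem' := by
    rintro _ _ ⟨G, hG, rfl⟩ ⟨H, hH, rfl⟩
    let K : FinGraph := ⟨G.order + H.order, (G.graph ⊕g H.graph).overFin (by simp)⟩
    have e : K.graph ≃g G.graph ⊕g H.graph := (SimpleGraph.overFinIso _ _).symm
    refine ⟨K, hU G hG H hH K ⟨e⟩, ?_⟩
    rw [homCount_congr F e, hF.card_hom_sum]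
    rfl

/-- A threshold beyond which the set of homomorphism numbers from a graph of order `k` is
periodic. -/
def threshold (k : ℕ) : ℕ := (k ^ k + 1) * k ^ k * k ^ k

/-- A period of the set of homomorphism numbers from a graph of order `k`. -/
def period (k : ℕ) : ℕ := (k ^ k).factorial

/-- Beyond the threshold, membership amounts to membership in a subgroup of ℤ. That subgroup
contains the period, since every positive generator is at most `k ^ k` and so divides `(k ^ k)!`. -/
theorem add_period_mem_homValues_iff (hF : F.graph.Connected)
    (hI : ClosedUnderInducedSubgraphs 𝒢) (hU : ClosedUnderDisjointUnions 𝒢) {h : ℕ}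
    (hh : threshold F.order ≤ h) :
    h + period F.order ∈ F.homValues 𝒢 ↔ h ∈ F.homValues 𝒢 := by
  classical
  -- For the empty class there is no value at all, not even 0, and the monoid is unavailable.
  rcases 𝒢.eq_empty_or_nonempty with rfl | hne
  · simp [homValues]
  set B := F.order ^ F.order
  have hk : 0 < F.order := Fin.pos_iff_nonempty.2 hF.nonempty
  have hB0 : 0 < B := pow_pos hk _
  have hh0 : 0 < h := lt_of_lt_of_le (Nat.mul_pos (Nat.mul_pos (Nat.succ_pos _) hB0) hB0) hh
  set H := homSubmonoid hF hI hU hne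
  -- The bound by `B` is automatic for `G.order ≤ F.order`; it only makes `A` a `Finset`.
  let A : Finset ℕ := (Finset.range (B + 1)).filter
    fun x => ∃ G ∈ 𝒢, G.order ≤ F.order ∧ F.homCount G = x
  set L : Submodule ℤ ℤ := Submodule.span ℤ ((fun x : ℕ => (x : ℤ)) '' (A : Set ℕ)) with hL
  have hHL : ∀ x ∈ H, (x : ℤ) ∈ L := by
    rintro _ ⟨G, hG, rfl⟩
    refine F.graph.card_hom_mem_of_forall_induce G.graph L fun s hs => ?_
    rw [← homCount_congr F (G.induceIso s)]
    have hs' : s.card ≤ F.order := by simpa using hs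
    refine Submodule.subset_span ⟨_, ?_, rfl⟩
    simp only [A, Finset.coe_filter, Finset.mem_range, Set.mem_ofPred_eq]
    refine ⟨Nat.lt_succ_of_le ((homCount_le _ _).trans (Nat.pow_le_pow_left hs' _)), G.induce s,
      hI.induce_mem hG s, hs', rfl⟩
  have hAH : ∀ x ∈ A, x ∈ H := by
    intro x hx
    obtain ⟨-, G, hG, -, hx⟩ := Finset.mem_filter.1 hx
    exact ⟨G, hG, hx⟩
  have hAB : ∀ x ∈ A, x ≤ B := fun x hx =>
    Nat.lt_succ_iff.1 (Finset.mem_range.1 (Finset.mem_filter.1 hx).1)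
  change h + period F.order ∈ H ↔ h ∈ H
  by_cases hA : ∃ a ∈ A, 0 < a
  · obtain ⟨a, ha, ha0⟩ := hA
    have hiff : ∀ x, threshold F.order ≤ x → (x ∈ H ↔ (x : ℤ) ∈ L) := fun x hx =>
      ⟨hHL x, fun hx' => H.mem_of_mem_intSpan hAH hAB ha ha0 hx' hx⟩
    rw [hiff _ hh, hiff _ (hh.trans (Nat.le_add_right _ _)), Nat.cast_add]
    refine L.add_mem_iff_left ?_
    obtain ⟨t, ht⟩ : a ∣ period F.order := Nat.dvd_factorial ha0 (hAB a ha)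
    rw [ht, Nat.cast_mul, mul_comm]
    exact L.smul_mem (t : ℤ) (Submodule.subset_span ⟨a, ha, rfl⟩)
  -- All generators are 0, so 0 is the only value, while `h` and `h + period` are positive.
  · push Not at hA
    have hL0 : L = ⊥ := by
      rw [hL, Submodule.span_eq_bot]
      rintro _ ⟨x, hx, rfl⟩
      have := hA x hx
      simpa using this
    have hno : ∀ x, 0 < x → x ∉ H := fun x hx hxH => by
      have := hHL x hxH
      rw [hL0, Submodule.mem_bot] at this
      omega
    exact ⟨fun h' => absurd h' (hno _ (by omega)), fun h' => absurd h' (hno _ hh0)⟩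

end FinGraph

/-! ### Closure properties of primitive recursive and computable functions -/

section Computability

variable {α : Type*} [Primcodable α]

theorem Primrec.nat_pow : Primrec₂ ((· ^ ·) : ℕ → ℕ → ℕ) :=
  Primrec₂.unpaired'.1 Nat.Primrec.pow

theorem Primrec.nat_factorial : Primrec Nat.factorial := by
  refine (Primrec.nat_rec₁ (f := fun n x => (n + 1) * x) 1 ?_).of_eq fun n => ?_
  · exact (Primrec.nat_mul.comp (Primrec.succ.comp Primrec.fst) Primrec.snd).to₂
  · induction n with
    | zero => rfl
    | succ n ih => rw [Nat.factorial_succ, ← ih]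

theorem Primrec.nat_testBit : Primrec₂ Nat.testBit := by
  have : PrimrecRel fun x i : ℕ => x / 2 ^ i % 2 = 1 :=
    Primrec.eq.comp (Primrec.nat_mod.comp (Primrec.nat_div.comp Primrec.fst
      (Primrec.nat_pow.comp (Primrec.const 2) Primrec.snd)) (Primrec.const 2)) (Primrec.const 1)
  exact this.decide.of_eq fun x i => Nat.testBit_eq_decide_div_mod_eq.symm

theorem PrimrecRel.forall_lt_comp {R : α → ℕ → Prop} (hR : PrimrecRel R) {f : α → ℕ}
    (hf : Primrec f) : PrimrecPred fun a => ∀ x < f a, R a x :=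
  ((PrimrecRel.forall_mem_list hR.swap).comp (Primrec.list_range.comp hf) Primrec.id).of_eq
    fun a => by simp [Function.swap]

theorem Primrec.nat_count {R : α → ℕ → Prop} [DecidableRel R] (hR : PrimrecRel R) {f : α → ℕ}
    (hf : Primrec f) : Primrec fun a => Nat.count (R a) (f a) := by
  have h : Primrec₂ fun (a : α) (p : ℕ × ℕ) => p.2 + if R a p.1 then 1 else 0 :=
    Primrec.nat_add.comp (Primrec.snd.comp Primrec.snd) (Primrec.ite
      (hR.comp Primrec.fst (Primrec.fst.comp Primrec.snd)) (Primrec.const 1) (Primrec.const 0))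
  refine (Primrec.nat_rec' hf (Primrec.const 0) h).of_eq fun a => ?_
  induction f a with
  | zero => simp
  | succ n ih => rw [Nat.count_succ, ← ih]

theorem Computable.exists_lt {q : α → ℕ → Bool} (hq : Computable₂ q) {f : α → ℕ}
    (hf : Computable f) : Computable fun a => decide (∃ x < f a, q a x = true) := by
  have h : Computable₂ fun (a : α) (p : ℕ × Bool) => p.2 || q a p.1 :=
    Primrec.or.to_comp.comp (Computable.snd.comp Computable.snd)
      (hq.comp Computable.fst (Computable.fst.comp Computable.snd))
  refine (Computable.nat_rec hf (Computable.const false) h).of_eq fun a => ?_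
  induction f a with
  | zero => simp
  | succ n ih =>
    simp only [ih, Nat.lt_succ_iff_lt_or_eq, or_and_right, exists_or, exists_eq_left]
    simp

theorem Computable.sum_range {q : α → ℕ → ℕ} (hq : Computable₂ q) {f : α → ℕ}
    (hf : Computable f) : Computable fun a => ∑ x ∈ Finset.range (f a), q a x := by
  have h : Computable₂ fun (a : α) (p : ℕ × ℕ) => p.2 + q a p.1 :=
    Primrec.nat_add.to_comp.comp (Computable.snd.comp Computable.snd)
      (hq.comp Computable.fst (Computable.fst.comp Computable.snd))
  refine (Computable.nat_rec hf (Computable.const 0) h).of_eq fun a => ?_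
  induction f a with
  | zero => simp
  | succ n ih => rw [Finset.sum_range_succ, ← ih]

end Computability

/-! ### Numeric codes of graphs and the brute-force decision procedure -/

theorem List.range_mul_eq_map_product (a m : ℕ) :
    List.range (a * m) =
      (List.finRange a ×ˢ List.finRange m).map fun p => (p.1 : ℕ) * m + p.2 := by
  have h1 : ∀ i : ℕ, (List.finRange m).map (fun j : Fin m => i * m + (j : ℕ)) =
      (List.range m).map (i * m + ·) := by
    intro i
    conv_rhs => rw [← List.map_coe_finRange_eq_range, List.map_map]
    rfl
  have h2 : (List.finRange a ×ˢ List.finRange m).map (fun p => (p.1 : ℕ) * m + p.2) =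
      (List.range a).flatMap fun i => (List.range m).map (i * m + ·) := by
    conv_rhs => rw [← List.map_coe_finRange_eq_range (n := a), List.flatMap_map]
    simp only [← h1, SProd.sprod, List.product, List.map_flatMap, List.map_map]
    rfl
  rw [h2]
  clear h1 h2
  induction a with
  | zero => simp
  | succ a ih =>
    rw [Nat.succ_mul, List.range_add, ih, List.range_succ, List.flatMap_append]
    simp

namespace FinGraph

/-- The number `g` encodes the adjacency matrix of `G`, read row by row, as its binary digits. -/
def HasCode (G : FinGraph) (g : ℕ) : Prop :=
  ∀ i j : Fin G.order, g.testBit (i * G.order + j) = true ↔ G.graph.Adj i j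

theorem hasCode_iff (G : FinGraph) (g : ℕ) :
    G.HasCode g ↔ G.encode = (List.range (G.order * G.order)).map g.testBit := by
  classical
  rw [List.range_mul_eq_map_product, encode, List.map_map, List.map_inj_left]
  simp only [HasCode, Prod.forall, Function.comp]
  constructor
  · intro h i j _
    rw [Bool.eq_iff_iff, h, decide_eq_true_iff]
  · intro h i j
    rw [← h i j (by simp), decide_eq_true_iff]

theorem exists_hasCode (G : FinGraph) : ∃ g < 2 ^ (G.order * G.order), G.HasCode g := by
  classical
  refine ⟨Nat.ofBits fun i : Fin (G.order * G.order) =>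
    decide (G.graph.Adj i.divNat i.modNat), Nat.ofBits_lt_two_pow _, fun i j => ?_⟩
  have hlt : (i : ℕ) * G.order + j < G.order * G.order := by
    have := i.2
    calc (i : ℕ) * G.order + j < i * G.order + G.order := by omega
      _ = (i + 1) * G.order := by ring
      _ ≤ _ := Nat.mul_le_mul_right _ this
  have hj := j.2
  rw [Nat.testBit_ofBits_lt _ _ hlt, decide_eq_true_iff]
  have h1 : Fin.divNat ⟨(i : ℕ) * G.order + j, hlt⟩ = i := by
    ext
    simp only [Fin.divNat]
    rw [mul_comm, Nat.mul_add_div (by omega), Nat.div_eq_of_lt hj, add_zero]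
  have h2 : Fin.modNat ⟨(i : ℕ) * G.order + j, hlt⟩ = j := by
    ext
    simp only [Fin.modNat]
    rw [mul_comm, Nat.mul_add_mod, Nat.mod_eq_of_lt hj]
  rw [h1, h2]

/-- Whether the base-`m` digits of `c` are the values of a homomorphism between the graphs of
orders `k` and `m` encoded by `f` and `g`. -/
def IsHomCode (k f m g c : ℕ) : Prop :=
  ∀ i < k, ∀ j < k, f.testBit (i * k + j) = true →
    g.testBit (c / m ^ i % m * m + c / m ^ j % m) = true

instance (k f m g : ℕ) : DecidablePred (IsHomCode k f m g) := fun _ => by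
  unfold IsHomCode; infer_instance

/-- Through base-`m` digits (`finFunctionFinEquiv`), the numbers below `m ^ k` are exactly the maps
between the vertex sets. -/
theorem count_isHomCode {F G : FinGraph} {f g : ℕ} (hf : F.HasCode f) (hg : G.HasCode g) :
    Nat.count (IsHomCode F.order f G.order g) (G.order ^ F.order) = F.homCount G := by
  have key : ∀ c : Fin (G.order ^ F.order), IsHomCode F.order f G.order g c ↔
      ∀ i j, F.graph.Adj i j → G.graph.Adj (finFunctionFinEquiv.symm c i)
        (finFunctionFinEquiv.symm c j) := by
    intro c
    simp only [← hf _ _, ← hg _ _, finFunctionFinEquiv_symm_apply_val, IsHomCode, Fin.forall_iff]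
  let : Fintype {c // c < G.order ^ F.order ∧ IsHomCode F.order f G.order g c} :=
    Nat.CountSet.fintype _ _
  rw [Nat.count_eq_card_fintype, homCount]
  refine (Nat.card_eq_fintype_card.symm.trans ?_)
  refine (Nat.card_congr ?_).symm
  calc (F.graph →g G.graph)
      ≃ {φ : Fin F.order → Fin G.order // ∀ i j, F.graph.Adj i j → G.graph.Adj (φ i) (φ j)} :=
        ⟨fun φ => ⟨φ, fun _ _ h => φ.map_adj h⟩, fun φ => ⟨φ.1, fun {_ _} h => φ.2 _ _ h⟩,
          fun _ => rfl, fun _ => rfl⟩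
    _ ≃ {c : Fin (G.order ^ F.order) // IsHomCode F.order f G.order g c} :=
        (finFunctionFinEquiv.symm.subtypeEquiv fun c => key c).symm
    _ ≃ {c : ℕ // c < G.order ^ F.order ∧ IsHomCode F.order f G.order g c} :=
        ⟨fun c => ⟨c.1, c.1.2, c.2⟩, fun c => ⟨⟨c.1, c.2.1⟩, c.2.2⟩, fun _ => rfl, fun _ => rfl⟩

theorem primrec_count_isHomCode : Primrec fun p : (ℕ × ℕ) × (ℕ × ℕ) =>
    Nat.count (IsHomCode p.1.1 p.1.2 p.2.1 p.2.2) (p.2.1 ^ p.1.1) := by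
  open Primrec in
  have hR : PrimrecRel fun (p : (ℕ × ℕ) × (ℕ × ℕ)) (c : ℕ) =>
      IsHomCode p.1.1 p.1.2 p.2.1 p.2.2 c := by
    have hk : Primrec fun q : ((ℕ × ℕ) × (ℕ × ℕ)) × ℕ => q.1.1.1 := fst.comp (fst.comp fst)
    refine PrimrecRel.forall_lt_comp (α := ((ℕ × ℕ) × (ℕ × ℕ)) × ℕ)
      (R := fun q i => ∀ j < q.1.1.1, q.1.1.2.testBit (i * q.1.1.1 + j) = true →
        q.1.2.2.testBit (q.2 / q.1.2.1 ^ i % q.1.2.1 * q.1.2.1 +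
          q.2 / q.1.2.1 ^ j % q.1.2.1) = true) ?_ hk
    refine PrimrecRel.forall_lt_comp (α := (((ℕ × ℕ) × (ℕ × ℕ)) × ℕ) × ℕ)
      (R := fun r j => r.1.1.1.2.testBit (r.2 * r.1.1.1.1 + j) = true →
        r.1.1.2.2.testBit (r.1.2 / r.1.1.2.1 ^ r.2 % r.1.1.2.1 * r.1.1.2.1 +
          r.1.2 / r.1.1.2.1 ^ j % r.1.1.2.1) = true) ?_ (hk.comp fst)
    have hq : Primrec fun x : ((((ℕ × ℕ) × (ℕ × ℕ)) × ℕ) × ℕ) × ℕ => x.1.1.1 :=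
      fst.comp (fst.comp fst)
    have hk : Primrec fun x : ((((ℕ × ℕ) × (ℕ × ℕ)) × ℕ) × ℕ) × ℕ => x.1.1.1.1.1 :=
      fst.comp (fst.comp hq)
    have hf : Primrec fun x : ((((ℕ × ℕ) × (ℕ × ℕ)) × ℕ) × ℕ) × ℕ => x.1.1.1.1.2 :=
      snd.comp (fst.comp hq)
    have hm : Primrec fun x : ((((ℕ × ℕ) × (ℕ × ℕ)) × ℕ) × ℕ) × ℕ => x.1.1.1.2.1 :=
      fst.comp (snd.comp hq)
    have hg : Primrec fun x : ((((ℕ × ℕ) × (ℕ × ℕ)) × ℕ) × ℕ) × ℕ => x.1.1.1.2.2 :=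
      snd.comp (snd.comp hq)
    have hc : Primrec fun x : ((((ℕ × ℕ) × (ℕ × ℕ)) × ℕ) × ℕ) × ℕ => x.1.1.2 :=
      snd.comp (fst.comp fst)
    have hi : Primrec fun x : ((((ℕ × ℕ) × (ℕ × ℕ)) × ℕ) × ℕ) × ℕ => x.1.2 := snd.comp fst
    have hj : Primrec fun x : ((((ℕ × ℕ) × (ℕ × ℕ)) × ℕ) × ℕ) × ℕ => x.2 := snd
    have h1 := nat_testBit.comp hf (nat_add.comp (nat_mul.comp hi hk) hj)
    have h2 := nat_testBit.comp hg (nat_add.comp (nat_mul.comp (nat_mod.comp (nat_div.comp hc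
      (nat_pow.comp hm hi)) hm) hm) (nat_mod.comp (nat_div.comp hc (nat_pow.comp hm hj)) hm))
    exact ((Primrec.eq.comp h1 (Primrec.const true)).not.or
      (Primrec.eq.comp h2 (Primrec.const true))).of_eq fun _ => imp_iff_not_or.symm
  exact nat_count hR (nat_pow.comp (fst.comp snd) (fst.comp fst))

/-- Search over all orders `m ≤ h * k` and all matrices `g < 2 ^ (m * m)`. The function `D` is
total, also on numbers that arise from unfinished inputs; the transducer evaluates it on those too.
-/
theorem exists_computable_homValues (𝒢 : Set FinGraph) (hD : DecidableMembership 𝒢)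
    (hI : ClosedUnderInducedSubgraphs 𝒢) :
    ∃ D : (ℕ × ℕ) × ℕ → Bool, Computable D ∧
      ∀ (F : FinGraph) (f h : ℕ), F.HasCode f →
        (D ((F.order, f), h) = true ↔ h ∈ F.homValues 𝒢) := by
  obtain ⟨dec, hdec⟩ := hD
  let mem : List Bool → Bool := fun w => decide (∃ G ∈ 𝒢, G.encode = w)
  have hmem : Computable mem := hdec
  let q : ((ℕ × ℕ) × ℕ) × ℕ → ℕ → Bool := fun x g =>
    mem ((List.range (x.2 * x.2)).map g.testBit) &&
      decide (Nat.count (IsHomCode x.1.1.1 x.1.1.2 x.2 g) (x.2 ^ x.1.1.1) = x.1.2)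
  open Computable in
  have hq : Computable₂ q := by
    have hbits : Primrec fun y : (((ℕ × ℕ) × ℕ) × ℕ) × ℕ =>
        (List.range (y.1.2 * y.1.2)).map y.2.testBit :=
      Primrec.list_map (Primrec.list_range.comp (Primrec.nat_mul.comp
        (Primrec.snd.comp Primrec.fst) (Primrec.snd.comp Primrec.fst)))
        (Primrec.nat_testBit.comp (Primrec.snd.comp Primrec.fst) Primrec.snd)
    have hcount : Primrec fun y : (((ℕ × ℕ) × ℕ) × ℕ) × ℕ =>
        decide (Nat.count (IsHomCode y.1.1.1.1 y.1.1.1.2 y.1.2 y.2) (y.1.2 ^ y.1.1.1.1) = y.1.1.2) :=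
      (Primrec.eq.comp (primrec_count_isHomCode.comp (Primrec.pair
        (Primrec.fst.comp (Primrec.fst.comp Primrec.fst))
        (Primrec.pair (Primrec.snd.comp Primrec.fst) Primrec.snd)))
        (Primrec.snd.comp (Primrec.fst.comp Primrec.fst))).decide
    exact Primrec.and.to_comp.comp (hmem.comp hbits.to_comp) hcount.to_comp
  have h1 : Computable fun x : ((ℕ × ℕ) × ℕ) × ℕ =>
      decide (∃ g < 2 ^ (x.2 * x.2), q x g = true) :=
    Computable.exists_lt hq (Primrec.nat_pow.comp (Primrec.const 2)
      (Primrec.nat_mul.comp Primrec.snd Primrec.snd)).to_comp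
  have h2 : Computable fun x : (ℕ × ℕ) × ℕ =>
      decide (∃ m < x.2 * x.1.1 + 1, decide (∃ g < 2 ^ (m * m), q (x, m) g = true) = true) :=
    Computable.exists_lt (q := fun x m => decide (∃ g < 2 ^ (m * m), q (x, m) g = true))
      h1.to₂ (Primrec.succ.comp (Primrec.nat_mul.comp Primrec.snd
        (Primrec.fst.comp Primrec.fst))).to_comp
  refine ⟨_, h2, fun F f h hf => ?_⟩
  simp only [decide_eq_true_eq, q, mem, Bool.and_eq_true]
  constructor
  · rintro ⟨m, -, g, -, ⟨G, hG, hGg⟩, hcount⟩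
    have hm : G.order = m := by
      have := congrArg List.length hGg
      simpa [encode, List.length_product, Nat.mul_self_inj] using this
    subst hm
    refine ⟨G, hG, ?_⟩
    rw [← hcount, count_isHomCode hf ((hasCode_iff G g).2 hGg)]
  · intro hh
    obtain ⟨G, hG, hle, hcount⟩ := exists_order_le_of_mem_homValues hI hh
    obtain ⟨g, hg, hGg⟩ := G.exists_hasCode
    refine ⟨G.order, Nat.lt_succ_of_le hle, g, hg, ⟨G, hG, (hasCode_iff G g).1 hGg⟩, ?_⟩
    rw [count_isHomCode hf hGg, hcount]

end FinGraph

/-! ### Reduced numbers and a transducer with bounded states -/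

namespace FinGraph

/-- The representative of `x` modulo eventual equality with the given threshold and period. -/
def reduce (k x : ℕ) : ℕ :=
  if x < threshold k then x else threshold k + (x - threshold k) % period k

theorem period_pos (k : ℕ) : 0 < period k := Nat.factorial_pos _

theorem reduce_lt (k x : ℕ) : reduce k x < threshold k + period k := by
  have := Nat.mod_lt (x - threshold k) (period_pos k)
  have := period_pos k
  unfold reduce
  split_ifs <;> omega

theorem reduce_add_period {k x : ℕ} (hx : threshold k ≤ x) (t : ℕ) :
    reduce k (x + t * period k) = reduce k x := by
  unfold reduce
  rw [if_neg (by omega), if_neg (by omega), Nat.sub_add_comm hx, Nat.add_mul_mod_self_right]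

theorem exists_eq_reduce_add {k x : ℕ} (hx : threshold k ≤ x) :
    threshold k ≤ reduce k x ∧ ∃ t, x = reduce k x + t * period k := by
  have h := Nat.mod_add_div' (x - threshold k) (period k)
  rw [reduce, if_neg (by omega)]
  exact ⟨by omega, (x - threshold k) / period k, by omega⟩

theorem reduce_reduce_add (k x y : ℕ) : reduce k (reduce k x + y) = reduce k (x + y) := by
  by_cases hx : x < threshold k
  · have : reduce k x = x := if_pos hx
    rw [this]
  · obtain ⟨h1, t, ht⟩ := exists_eq_reduce_add (not_lt.1 hx)
    conv_rhs => rw [ht]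
    rw [add_right_comm, reduce_add_period (by omega)]

theorem reduce_reduce (k x : ℕ) : reduce k (reduce k x) = reduce k x :=
  reduce_reduce_add k x 0

/-- Equality after `reduce k` is a congruence for addition. Doubling the place value and adding
digits are additions, so `h` can be read without ever being stored in full. -/
theorem reduce_add_congr {k x x' y y' : ℕ} (hx : reduce k x = reduce k x')
    (hy : reduce k y = reduce k y') : reduce k (x + y) = reduce k (x' + y') := by
  rw [← reduce_reduce_add, hx, reduce_reduce_add, add_comm, ← reduce_reduce_add, hy,
    reduce_reduce_add, add_comm]

theorem reduce_mem_homValues_iff {F : FinGraph} {𝒢 : Set FinGraph} (hF : F.graph.Connected)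
    (hI : ClosedUnderInducedSubgraphs 𝒢) (hU : ClosedUnderDisjointUnions 𝒢) (h : ℕ) :
    reduce F.order h ∈ F.homValues 𝒢 ↔ h ∈ F.homValues 𝒢 := by
  by_cases hh : h < threshold F.order
  · rw [reduce, if_pos hh]
  · obtain ⟨h1, t, ht⟩ := exists_eq_reduce_add (not_lt.1 hh)
    conv_rhs => rw [ht]
    clear ht
    induction t with
    | zero => simp
    | succ t ih =>
      rw [Nat.succ_mul, ← add_assoc, add_period_mem_homValues_iff hF hI hU (by omega), ih]

theorem primrec_threshold : Primrec threshold := by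
  have h : Primrec fun k : ℕ => k ^ k := Primrec.nat_pow.comp Primrec.id Primrec.id
  exact Primrec.nat_mul.comp (Primrec.nat_mul.comp (Primrec.succ.comp h) h) h

theorem primrec_period : Primrec period :=
  Primrec.nat_factorial.comp (Primrec.nat_pow.comp Primrec.id Primrec.id)

theorem primrec_reduce : Primrec₂ reduce := by
  have hN := primrec_threshold.comp (Primrec.fst (α := ℕ) (β := ℕ))
  exact Primrec.ite (Primrec.nat_lt.comp Primrec.snd hN) Primrec.snd
    (Primrec.nat_add.comp hN (Primrec.nat_mod.comp (Primrec.nat_sub.comp Primrec.snd hN)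
      (primrec_period.comp Primrec.fst)))

/-- Input symbols as the numbers `4, …, 7`, whose last two binary digits are the part of the input
and the bit. -/
def symbolCode : Bool ⊕ Bool → ℕ
  | .inl b => 4 + b.toNat
  | .inr b => 6 + b.toNat

/-- One step of reading an instance. The state `((l, f), (p, r))` holds the number `l` of matrix
entries read, the number `f` with these binary digits, and, in reduced form, the value `r` of the
digits of `h` that have been read and the place value `p` of the next one. -/
def scan (b : ℕ) (x : (ℕ × ℕ) × (ℕ × ℕ)) : (ℕ × ℕ) × (ℕ × ℕ) :=
  -- Each matrix entry resets place value and value to `(1, 0)`, so the digits of `h` start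
  -- correctly. By then `l = k * k`, and the square root recovers `k`.
  if b / 2 % 2 = 0 then ((x.1.1 + 1, x.1.2 + b % 2 * 2 ^ x.1.1), (1, 0))
  else (x.1, (reduce x.1.1.sqrt (x.2.1 + x.2.1), reduce x.1.1.sqrt (x.2.2 + b % 2 * x.2.1)))

theorem scan_inl (b : Bool) (x : (ℕ × ℕ) × (ℕ × ℕ)) : scan (symbolCode (.inl b)) x =
    ((x.1.1 + 1, x.1.2 + b.toNat * 2 ^ x.1.1), (1, 0)) := by
  cases b <;> simp [scan, symbolCode]

theorem scan_inr (b : Bool) (x : (ℕ × ℕ) × (ℕ × ℕ)) : scan (symbolCode (.inr b)) x =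
    (x.1, (reduce x.1.1.sqrt (x.2.1 + x.2.1),
      reduce x.1.1.sqrt (x.2.2 + b.toNat * x.2.1))) := by
  cases b <;> simp [scan, symbolCode]

theorem primrec_scan : Primrec₂ scan := by
  open Primrec in
  have hb : Primrec fun y : ℕ × ((ℕ × ℕ) × (ℕ × ℕ)) => y.1 := fst
  have hl : Primrec fun y : ℕ × ((ℕ × ℕ) × (ℕ × ℕ)) => y.2.1.1 := fst.comp (fst.comp snd)
  have hf : Primrec fun y : ℕ × ((ℕ × ℕ) × (ℕ × ℕ)) => y.2.1.2 := snd.comp (fst.comp snd)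
  have hp : Primrec fun y : ℕ × ((ℕ × ℕ) × (ℕ × ℕ)) => y.2.2.1 := fst.comp (snd.comp snd)
  have hr : Primrec fun y : ℕ × ((ℕ × ℕ) × (ℕ × ℕ)) => y.2.2.2 := snd.comp (snd.comp snd)
  have h2 : Primrec fun _ : ℕ × ((ℕ × ℕ) × (ℕ × ℕ)) => 2 := Primrec.const 2
  exact Primrec.ite
    (Primrec.eq.comp (nat_mod.comp (nat_div.comp hb h2) h2) (Primrec.const 0))
    (pair (pair (succ.comp hl) (nat_add.comp hf (nat_mul.comp (nat_mod.comp hb h2)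
      (nat_pow.comp h2 hl)))) (Primrec.const (1, 0)))
    (pair (fst.comp snd) (pair (primrec_reduce.comp (nat_sqrt.comp hl) (nat_add.comp hp hp))
      (primrec_reduce.comp (nat_sqrt.comp hl)
        (nat_add.comp hr (nat_mul.comp (nat_mod.comp hb h2) hp)))))

/-- The state after reading a string. -/
def scanAll (w : List (Bool ⊕ Bool)) : (ℕ × ℕ) × (ℕ × ℕ) :=
  w.foldl (fun x a => scan (symbolCode a) x) ((0, 0), (0, 0))

theorem scanAll_concat (w : List (Bool ⊕ Bool)) (a : Bool ⊕ Bool) :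
    scanAll (w ++ [a]) = scan (symbolCode a) (scanAll w) := by
  simp [scanAll]

/-- The initial place value is 0 and becomes 1 only with the first entry; hence the separate clause
for non-empty `w`. -/
theorem scanAll_map_inl (w : List Bool) :
    (scanAll (w.map Sum.inl)).1.1 = w.length ∧
      (scanAll (w.map Sum.inl)).1.2 < 2 ^ w.length ∧
      (∀ i, (scanAll (w.map Sum.inl)).1.2.testBit i = w.getD i false) ∧
      (scanAll (w.map Sum.inl)).2.1 ≤ 1 ∧ (scanAll (w.map Sum.inl)).2.2 = 0 ∧
      (w ≠ [] → (scanAll (w.map Sum.inl)).2.1 = 1) := by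
  induction w using List.reverseRecOn with
  | nil => simp [scanAll]
  | append_singleton w b ih =>
    obtain ⟨h1, h2, h3, -⟩ := ih
    rw [List.map_append, List.map_singleton, scanAll_concat, scan_inl]
    refine ⟨by simp [h1], ?_, fun i => ?_, le_rfl, rfl, fun _ => rfl⟩
    · simp only [h1, List.length_append, List.length_singleton, pow_succ]
      have := Bool.toNat_le b
      have := Nat.mul_le_mul_right (2 ^ w.length) this
      omega
    · simp only [h1]
      rw [add_comm, mul_comm, Nat.testBit_two_pow_mul_add _ h2, h3]
      by_cases hi : i < w.length
      · rw [if_pos hi, List.getD_append _ _ _ _ hi]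
      · rw [if_neg hi, List.getD_append_right _ _ _ _ (not_lt.1 hi)]
        rcases i - w.length with _ | j
        · cases b <;> rfl
        · cases b <;> simp [Nat.testBit_succ]

/-- The invariant is modulo `reduce k`, since the initial place value 1 was not produced by
`reduce`; positivity of the period covers it in the bounds. -/
theorem scanAll_append (u : List (Bool ⊕ Bool)) {k : ℕ} (hu : (scanAll u).1.1 = k * k)
    (hp : (scanAll u).2.1 = 1) (hr : (scanAll u).2.2 = 0) (v : List Bool) :
    (scanAll (u ++ v.map Sum.inr)).1 = (scanAll u).1 ∧
      (scanAll (u ++ v.map Sum.inr)).2.1 ≤ threshold k + period k ∧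
      (scanAll (u ++ v.map Sum.inr)).2.2 ≤ threshold k + period k ∧
      reduce k (scanAll (u ++ v.map Sum.inr)).2.1 = reduce k (2 ^ v.length) ∧
      reduce k (scanAll (u ++ v.map Sum.inr)).2.2 =
        reduce k (Nat.ofDigits 2 (v.map Bool.toNat)) := by
  induction v using List.reverseRecOn with
  | nil =>
    have := period_pos k
    simp only [List.map_nil, List.append_nil, hp, hr, Nat.ofDigits_nil, List.length_nil, pow_zero]
    exact ⟨trivial, by omega, by omega, trivial, trivial⟩
  | append_singleton v b ih =>
    obtain ⟨h1, h2, h3, h4, h5⟩ := ih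
    rw [List.map_append, List.map_singleton, ← List.append_assoc, scanAll_concat, scan_inr]
    simp only [h1, hu, Nat.sqrt_eq, List.map_append, List.map_singleton, List.length_append,
      List.length_singleton, Nat.ofDigits_append, List.length_map, Nat.ofDigits_singleton,
      reduce_reduce]
    refine ⟨trivial, (reduce_lt _ _).le, (reduce_lt _ _).le, ?_, reduce_add_congr h5 ?_⟩
    · rw [pow_succ, mul_two]
      exact reduce_add_congr h4 h4
    · cases b
      · simp
      · simpa using h4

theorem ofDigits_encodeNat (n : ℕ) :
    Nat.ofDigits 2 ((Computability.encodeNat n).map Bool.toNat) = n := by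
  have hpos : ∀ m : PosNum,
      Nat.ofDigits 2 ((Computability.encodePosNum m).map Bool.toNat) = (m : ℕ) := by
    intro m
    induction m with
    | one => simp [Computability.encodePosNum]
    | bit0 m ih =>
      rw [Computability.encodePosNum, List.map_cons, Nat.ofDigits_cons, ih, PosNum.cast_bit0]
      simp; ring
    | bit1 m ih =>
      rw [Computability.encodePosNum, List.map_cons, Nat.ofDigits_cons, ih, PosNum.cast_bit1]
      simp; ring
  conv_rhs => rw [← Num.to_of_nat n]
  rw [Computability.encodeNat]
  rcases (n : Num) with _ | m
  · simp [Computability.encodeNum]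
  · exact hpos m

/-- A bound on the numbers that occur while an instance with a graph of order `k` is read. -/
def scanBound (k : ℕ) : ℕ := k * k + 2 ^ (k * k) + threshold k + period k

theorem length_encode (F : FinGraph) : F.encode.length = F.order * F.order := by
  simp [encode, List.length_product]

theorem scanAll_encode (F : FinGraph) (hF : 0 < F.order) :
    ∃ f, scanAll (F.encode.map Sum.inl) = ((F.order * F.order, f), (1, 0)) ∧ F.HasCode f := by
  obtain ⟨h1, -, h3, -, h5, h6⟩ := scanAll_map_inl F.encode
  have hlen := F.length_encode
  have hne : F.encode ≠ [] := by
    intro h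
    rw [h, List.length_nil] at hlen
    exact (Nat.mul_pos hF hF).ne hlen
  refine ⟨(scanAll (F.encode.map Sum.inl)).1.2,
    Prod.ext (Prod.ext (h1.trans hlen) rfl) (Prod.ext (h6 hne) h5), ?_⟩
  rw [hasCode_iff]
  refine List.ext_getElem (by simp [hlen]) fun i hi hi' => ?_
  rw [List.getElem_map, List.getElem_range, h3, List.getD_eq_getElem _ _ hi]

/-- All prefixes matter, because the cost of each transition depends on the current state. A prefix
ends within the matrix or within the digits of `h`, and neither bound involves `h`. -/
theorem scanAll_le_of_prefix {F : FinGraph} (hF : 0 < F.order) {h : ℕ} {w : List (Bool ⊕ Bool)}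
    (hw : w <+: encodeWithNumber (F, h)) :
    (scanAll w).1.1 ≤ scanBound F.order ∧ (scanAll w).1.2 ≤ scanBound F.order ∧
      (scanAll w).2.1 ≤ scanBound F.order ∧ (scanAll w).2.2 ≤ scanBound F.order := by
  have hlen := F.length_encode
  have hperiod := period_pos F.order
  unfold scanBound
  have hmatrix : ∀ v : List Bool, v.length ≤ F.order * F.order →
      (scanAll (v.map Sum.inl)).1.1 ≤ F.order * F.order ∧
        (scanAll (v.map Sum.inl)).1.2 ≤ 2 ^ (F.order * F.order) := by
    intro v hv
    obtain ⟨h1, h2, -⟩ := scanAll_map_inl v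
    exact ⟨h1.le.trans hv, h2.le.trans (Nat.pow_le_pow_right two_pos hv)⟩
  obtain ⟨u, hu⟩ := hw
  rw [encodeWithNumber, List.append_eq_append_iff] at hu
  rcases hu with ⟨v, hv, -⟩ | ⟨v, rfl, hv⟩
  · obtain ⟨w', v', hw', rfl, rfl⟩ := List.map_eq_append_iff.1 hv
    have hle : w'.length ≤ F.order * F.order := by
      rw [← hlen, hw', List.length_append]; omega
    obtain ⟨h1, h2⟩ := hmatrix w' hle
    obtain ⟨-, -, -, h4, h5, -⟩ := scanAll_map_inl w'
    refine ⟨?_, ?_, ?_, ?_⟩ <;> omega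
  · obtain ⟨v', u', -, rfl, -⟩ := List.map_eq_append_iff.1 hv
    obtain ⟨h1, h2⟩ := hmatrix F.encode hlen.le
    obtain ⟨f, hf, -⟩ := F.scanAll_encode hF
    obtain ⟨h3, h4, h5, -⟩ := scanAll_append (F.encode.map Sum.inl) (k := F.order)
      (by rw [hf]) (by rw [hf]) (by rw [hf]) v'
    dsimp only
    rw [h3]
    refine ⟨?_, ?_, ?_, ?_⟩ <;> omega

theorem exists_scanAll_encodeWithNumber {F : FinGraph} (hF : 0 < F.order) (h : ℕ) :
    ∃ f p r, scanAll (encodeWithNumber (F, h)) = ((F.order * F.order, f), (p, r)) ∧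
      F.HasCode f ∧ reduce F.order r = reduce F.order h := by
  obtain ⟨f, hf, hcode⟩ := F.scanAll_encode hF
  obtain ⟨h3, -, -, -, h5⟩ := scanAll_append (F.encode.map Sum.inl) (k := F.order)
    (by rw [hf]) (by rw [hf]) (by rw [hf]) (Computability.encodeNat h)
  rw [ofDigits_encodeNat] at h5
  refine ⟨f, _, _, Prod.ext ?_ rfl, hcode, h5⟩
  rw [encodeWithNumber, h3, hf]

/-- A state together with an answer bit as a single number. -/
def packState (x : ((ℕ × ℕ) × (ℕ × ℕ)) × Bool) : ℕ :=
  2 * Nat.pair (Nat.pair x.1.1.1 x.1.1.2) (Nat.pair x.1.2.1 x.1.2.2) + x.2.toNat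

def unpackState (s : ℕ) : (ℕ × ℕ) × (ℕ × ℕ) :=
  ((s / 2).unpair.1.unpair, (s / 2).unpair.2.unpair)

theorem unpackState_packState (x : ((ℕ × ℕ) × (ℕ × ℕ)) × Bool) :
    unpackState (packState x) = x.1 := by
  have : packState x / 2 =
      Nat.pair (Nat.pair x.1.1.1 x.1.1.2) (Nat.pair x.1.2.1 x.1.2.2) := by
    have := Bool.toNat_le x.2
    unfold packState
    generalize Nat.pair (Nat.pair _ _) _ = y
    rcases x.2
    · simp
    · simp; omega
  simp [unpackState, this]

theorem packState_mod_two (x : ((ℕ × ℕ) × (ℕ × ℕ)) × Bool) :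
    packState x % 2 = 1 ↔ x.2 = true := by
  rcases x with ⟨x, _ | _⟩ <;> simp [packState]

theorem packState_le {x : ((ℕ × ℕ) × (ℕ × ℕ)) × Bool} {m : ℕ} (h1 : x.1.1.1 ≤ m)
    (h2 : x.1.1.2 ≤ m) (h3 : x.1.2.1 ≤ m) (h4 : x.1.2.2 ≤ m) :
    packState x ≤ 2 * ((m + 1) ^ 2 + 1) ^ 2 + 1 := by
  have hpair : ∀ {a b c : ℕ}, a ≤ c → b ≤ c → Nat.pair a b ≤ (c + 1) ^ 2 := fun ha hb =>
    (Nat.pair_lt_max_add_one_sq _ _).le.trans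
      (Nat.pow_le_pow_left (Nat.succ_le_succ (max_le ha hb)) 2)
  have h := hpair (hpair h1 h2) (hpair h3 h4)
  have := Bool.toNat_le x.2
  unfold packState
  omega

theorem primrec_packState : Primrec packState := by
  open Primrec in
  exact nat_add.comp (nat_double.comp (Primrec₂.natPair.comp
      (Primrec₂.natPair.comp (fst.comp (fst.comp fst)) (snd.comp (fst.comp fst)))
      (Primrec₂.natPair.comp (fst.comp (snd.comp fst)) (snd.comp (snd.comp fst)))))
    ((Primrec.dom_bool Bool.toNat).comp snd)

theorem primrec_unpackState : Primrec unpackState := by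
  open Primrec in
  have h : Primrec fun s : ℕ => (s / 2).unpair :=
    unpair.comp (nat_div.comp Primrec.id (Primrec.const 2))
  exact pair (unpair.comp (fst.comp h)) (unpair.comp (snd.comp h))

/-- The question can be answered by a computable sequential transducer on natural numbers whose
states are bounded in terms of the order of the graph. -/
theorem exists_transition (𝒢 : Set FinGraph) (hD : DecidableMembership 𝒢)
    (hI : ClosedUnderInducedSubgraphs 𝒢) (hU : ClosedUnderDisjointUnions 𝒢) :
    ∃ (δ : ℕ → ℕ → ℕ) (C : ℕ → ℕ), Computable₂ δ ∧ Computable C ∧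
      ∀ (F : FinGraph), F.graph.Connected → ∀ h : ℕ,
        (∀ w, w <+: encodeWithNumber (F, h) →
          w.foldl (fun s a => δ (symbolCode a) s) 0 ≤ C F.order) ∧
        ((encodeWithNumber (F, h)).foldl (fun s a => δ (symbolCode a) s) 0 % 2 = 1 ↔
          h ∈ F.homValues 𝒢) := by
  obtain ⟨D, hDc, hDs⟩ := exists_computable_homValues 𝒢 hD hI
  let answer : (ℕ × ℕ) × (ℕ × ℕ) → Bool := fun x => D ((x.1.1.sqrt, x.1.2), x.2.2)
  have hanswer : Computable answer := by
    open Primrec in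
    exact hDc.comp (pair (pair (nat_sqrt.comp (fst.comp fst)) (snd.comp fst))
      (snd.comp snd)).to_comp
  -- The old answer bit is dropped and a new one computed after every symbol, so no separate final
  -- evaluation is needed.
  let δ : ℕ → ℕ → ℕ := fun b s =>
    packState (scan b (unpackState s), answer (scan b (unpackState s)))
  have hstep : Computable fun y : ℕ × ℕ => scan y.1 (unpackState y.2) :=
    (primrec_scan.comp Primrec.fst (primrec_unpackState.comp Primrec.snd)).to_comp
  have hδ : Computable₂ δ :=
    primrec_packState.to_comp.comp (hstep.pair (hanswer.comp hstep))
  have hbound : Primrec scanBound := by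
    open Primrec in
    have hk : Primrec fun k : ℕ => k * k := nat_mul.comp Primrec.id Primrec.id
    exact nat_add.comp (nat_add.comp (nat_add.comp hk (nat_pow.comp (Primrec.const 2) hk))
      primrec_threshold) primrec_period
  have hC : Computable fun k => 2 * ((scanBound k + 1) ^ 2 + 1) ^ 2 + 1 := by
    open Primrec in
    have h2 : Primrec fun _ : ℕ => 2 := Primrec.const 2
    exact (nat_double_succ.comp (nat_pow.comp (succ.comp (nat_pow.comp (succ.comp hbound) h2))
      h2)).to_comp
  have hfold : ∀ w : List (Bool ⊕ Bool), ∃ b : Bool,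
      w.foldl (fun s a => δ (symbolCode a) s) 0 = packState (scanAll w, b) ∧
        (w ≠ [] → b = answer (scanAll w)) := by
    intro w
    induction w using List.reverseRecOn with
    -- The zero state with answer `false` is packed to 0, the initial value of the fold.
    | nil => exact ⟨false, rfl, by simp⟩
    | append_singleton w a ih =>
      obtain ⟨b, hb, -⟩ := ih
      refine ⟨answer (scanAll (w ++ [a])), ?_, fun _ => rfl⟩
      rw [List.foldl_append, hb, scanAll_concat]
      simp only [List.foldl_cons, List.foldl_nil, δ, unpackState_packState]
  refine ⟨δ, _, hδ, hC, fun F hF h => ⟨fun w hw => ?_, ?_⟩⟩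
  · have hk : 0 < F.order := Fin.pos_iff_nonempty.2 hF.nonempty
    obtain ⟨b, hb, -⟩ := hfold w
    obtain ⟨h1, h2, h3, h4⟩ := scanAll_le_of_prefix hk hw
    rw [hb]
    exact packState_le h1 h2 h3 h4
  · have hk : 0 < F.order := Fin.pos_iff_nonempty.2 hF.nonempty
    have hne : encodeWithNumber (F, h) ≠ [] := by
      intro h'
      have := congrArg List.length h'
      simp only [encodeWithNumber, List.length_append, List.length_map, length_encode,
        List.length_nil] at this
      have := Nat.mul_pos hk hk
      omega
    obtain ⟨b, hb, hb'⟩ := hfold (encodeWithNumber (F, h))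
    obtain ⟨f, p, r, hx, hcode, hr⟩ := exists_scanAll_encodeWithNumber hk h
    rw [hb, packState_mod_two, hb' hne, hx]
    simp only [answer, Nat.sqrt_eq]
    rw [hDs F f r hcode, ← reduce_mem_homValues_iff hF hI hU, hr,
      reduce_mem_homValues_iff hF hI hU]

end FinGraph

/-! ### Binary numerals on the stacks of the evaluator -/

namespace Turing.PartrecToTM2

open ToPartrec Function

/-- The hypothesis excludes 0, which is written without digits. -/
theorem trNat_bit (b : Bool) (n : ℕ) (h : n ≠ 0 ∨ b = true) :
    trNat (Nat.bit b n) = (bif b then Γ'.bit1 else Γ'.bit0) :: trNat n := by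
  have hc : ((Nat.bit b n : ℕ) : Num) = bif b then Num.bit1 (n : Num) else Num.bit0 (n : Num) := by
    rw [← Num.ofNat'_eq, Num.ofNat'_bit, ← Num.ofNat'_eq]
    cases b <;> rfl
  rw [trNat, hc, trNat]
  have hn : (n : Num) = 0 → n = 0 := fun h0 => by exact_mod_cast h0
  rcases hm : (n : Num) with _ | m
  · cases b
    · simp [hn hm] at h
    · rfl
  · cases b <;> rfl

theorem trNat_eq_cons {n : ℕ} (h : n ≠ 0) :
    trNat n = (bif n.bodd then Γ'.bit1 else Γ'.bit0) :: trNat n.div2 := by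
  conv_lhs => rw [← Nat.bit_bodd_div2 n]
  refine trNat_bit _ _ ?_
  by_contra! hc
  have := Nat.bit_bodd_div2 n
  rw [hc.1, Bool.eq_false_iff.2 hc.2] at this
  exact h (by simpa using this.symm)

theorem length_trNat_le (n : ℕ) : (trNat n).length ≤ n := by
  induction n using Nat.strong_induction_on with
  | _ n ih =>
    by_cases h : n = 0
    · simp [h]
    · rw [trNat_eq_cons h, List.length_cons]
      have hlt : n.div2 < n := Nat.binaryRec_decreasing h
      have := ih _ hlt
      omega

/-- Numerals start with the least significant digit, so the answer bit is on top of the stack. For 0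
the top is the separator, which is not `Γ'.bit1` either. -/
theorem head?_trList_singleton (n : ℕ) :
    (trList [n]).head? = some Γ'.bit1 ↔ n % 2 = 1 := by
  by_cases h : n = 0
  · simp [h]
  · rw [trList, trNat_eq_cons h, Nat.mod_two_of_bodd]
    cases n.bodd <;> simp

instance : Fintype K' := ⟨{.main, .rev, .aux, .stack}, fun x => by cases x <;> simp⟩

end Turing.PartrecToTM2

/-! ### A machine that loops over the input and calls the evaluator -/

namespace FoldMachine

open Turing Turing.PartrecToTM2 Turing.ToPartrec Function

/-- The labels for the control of the loop over the input. -/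
inductive Control
  | start
  | loop
  | finish
  | clear
  deriving DecidableEq

instance : Fintype Control := ⟨{.start, .loop, .finish, .clear}, fun x => by cases x <;> simp⟩

/-- The stacks are those of the evaluator of partial recursive functions, the input stack
`.inr false` and the output stack `.inr true`. -/
abbrev Alphabet : K' ⊕ Bool → Type
  | .inl _ => Γ'
  | .inr false => Γ'
  | .inr true => Bool

/-- Input symbols as stack symbols of the evaluator. -/
def symbolEquiv : Γ' ≃ Bool ⊕ Bool where
  toFun
    | .consₗ => .inl false
    | .cons => .inl true
    | .bit0 => .inr false
    | .bit1 => .inr true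
  invFun
    | .inl false => .consₗ
    | .inl true => .cons
    | .inr false => .bit0
    | .inr true => .bit1
  left_inv x := by cases x <;> rfl
  right_inv x := by rcases x with (_ | _) | (_ | _) <;> rfl

/-- The second binary digit of the number of an input symbol. -/
def partDigit : Option Γ' → Γ'
  | some .bit0 => .bit1
  | some .bit1 => .bit1
  | _ => .bit0

/-- The last binary digit of the number of an input symbol. -/
def bitDigit : Option Γ' → Γ'
  | some .cons => .bit1
  | some .bit1 => .bit1
  | _ => .bit0

variable (S : Finset Λ')

/-- Labels outside `S` are identified with the head of the loop. -/
def label (q : Λ') : S ⊕ Control :=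
  if h : q ∈ S then .inl ⟨q, h⟩ else .inr .loop

/-- A statement of the evaluator, with halting replaced by a jump to the head of the loop. -/
def liftStmt : TM2.Stmt (fun _ : K' => Γ') Λ' (Option Γ') →
    TM2.Stmt Alphabet (S ⊕ Control) (Option Γ')
  | .push k f q => .push (.inl k) f (liftStmt q)
  | .peek k f q => .peek (.inl k) f (liftStmt q)
  | .pop k f q => .pop (.inl k) f (liftStmt q)
  | .load f q => .load f (liftStmt q)
  | .branch f q₁ q₂ => .branch f (liftStmt q₁) (liftStmt q₂)
  | .goto l => .goto fun v => label S (l v)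
  | .halt => .goto fun _ => .inr .loop

/-- The program that folds a transition function over the input. The transition function is
evaluated by the subroutine starting at `q₀`. -/
def program (q₀ : Λ') : S ⊕ Control → TM2.Stmt Alphabet (S ⊕ Control) (Option Γ')
  | .inl q => liftStmt S (tr q)
  | .inr .start => .push (.inl .main) (fun _ => Γ'.cons) (.goto fun _ => .inr .loop)
  | .inr .loop => .pop (.inr false) (fun _ x => x) (.branch Option.isSome
      (.push (.inl .main) (fun _ => Γ'.cons) <| .push (.inl .main) (fun _ => Γ'.bit1) <|
        .push (.inl .main) partDigit <| .push (.inl .main) bitDigit <|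
        .load (fun _ => none) <| .goto fun _ => label S q₀)
      (.goto fun _ => .inr .finish))
  | .inr .finish => .pop (.inl .main) (fun _ x => x) <|
      .push (.inr true) (fun v => decide (v = some Γ'.bit1)) <|
      .load (fun _ => none) <| .goto fun _ => .inr .clear
  | .inr .clear => .pop (.inl .main) (fun _ x => x) (.branch Option.isSome
      (.goto fun _ => .inr .clear) .halt)

/-- The contents of all stacks. -/
def stackFun (T : K' → List Γ') (input : List Γ') (output : List Bool) :
    ∀ k, List (Alphabet k)
  | .inl k => T k
  | .inr false => input
  | .inr true => output

theorem stackFun_update_inl (T : K' → List Γ') (i : List Γ') (o : List Bool) (k : K')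
    (L : List Γ') : update (stackFun T i o) (.inl k) L = stackFun (update T k L) i o := by
  funext x
  rcases x with x | _ | _
  · by_cases h : x = k
    · subst h; simp [stackFun]
    · simp [stackFun, h]
  · simp [stackFun]
  · simp [stackFun]

theorem stackFun_update_input (T : K' → List Γ') (i : List Γ') (o : List Bool) (L : List Γ') :
    update (stackFun T i o) (.inr false) L = stackFun T L o := by
  funext x
  rcases x with x | _ | _ <;> simp [stackFun]

theorem stackFun_update_output (T : K' → List Γ') (i : List Γ') (o : List Bool) (L : List Bool) :
    update (stackFun T i o) (.inr true) L = stackFun T i L := by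
  funext x
  rcases x with x | _ | _ <;> simp [stackFun]

/-- A configuration of the evaluator as a configuration of the loop. -/
def liftCfg (a : TM2.Cfg (fun _ : K' => Γ') Λ' (Option Γ')) (i : List Γ') :
    TM2.Cfg Alphabet (S ⊕ Control) (Option Γ') :=
  ⟨some (a.l.elim (.inr .loop) (label S)), a.var, stackFun a.stk i []⟩

theorem stepAux_liftStmt (q : TM2.Stmt (fun _ : K' => Γ') Λ' (Option Γ')) (v : Option Γ')
    (T : K' → List Γ') (i : List Γ') :
    TM2.stepAux (liftStmt S q) v (stackFun T i []) = liftCfg S (TM2.stepAux q v T) i := by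
  induction q generalizing v T with
  | push k f q ih =>
    rw [liftStmt, TM2.stepAux, TM2.stepAux, ← ih, ← stackFun_update_inl]; rfl
  | peek k f q ih => rw [liftStmt, TM2.stepAux, TM2.stepAux, ← ih]; rfl
  | pop k f q ih =>
    rw [liftStmt, TM2.stepAux, TM2.stepAux, ← ih, ← stackFun_update_inl]; rfl
  | load f q ih => rw [liftStmt, TM2.stepAux, TM2.stepAux, ← ih]
  | branch f q₁ q₂ ih₁ ih₂ =>
    rw [liftStmt, TM2.stepAux, TM2.stepAux]
    cases f v
    · exact ih₂ v T
    · exact ih₁ v T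
  | goto l => rfl
  | halt => rfl

section Simulation

/-- The stacks of the evaluator as a tuple. -/
abbrev Tuple : Type := (List Γ' × List Γ') × (List Γ' × List Γ')

def Tuple.get (t : Tuple) : K' → List Γ' := K'.elim t.1.1 t.1.2 t.2.1 t.2.2

def Tuple.set (k : K') (t : Tuple) (L : List Γ') : Tuple :=
  match k with
  | .main => ((L, t.1.2), t.2)
  | .rev => ((t.1.1, L), t.2)
  | .aux => (t.1, (L, t.2.2))
  | .stack => (t.1, (t.2.1, L))

theorem Tuple.get_set (k : K') (t : Tuple) (L : List Γ') :
    (t.set k L).get = update t.get k L := by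
  cases k <;> simp [Tuple.get, Tuple.set]

/-- A configuration of the evaluator, for the simulation by a primitive recursive function. -/
def toSim (a : TM2.Cfg (fun _ : K' => Γ') Λ' (Option Γ')) :
    (S ⊕ Control) × (Option Γ' × Tuple) :=
  (a.l.elim (.inr .loop) (label S), a.var,
    (a.stk .main, a.stk .rev), (a.stk .aux, a.stk .stack))

/-- One step of the evaluator. -/
def simStep (x : (S ⊕ Control) × (Option Γ' × Tuple)) : (S ⊕ Control) × (Option Γ' × Tuple) :=
  match x.1 with
  | .inl q => toSim S (TM2.stepAux (tr q) x.2.1 x.2.2.get)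
  | .inr _ => x

theorem simStep_toSim {a : TM2.Cfg (fun _ : K' => Γ') Λ' (Option Γ')} {q : Λ'} (hq : a.l = some q)
    (hqS : q ∈ S) : simStep S (toSim S a) = toSim S (TM2.stepAux (tr q) a.var a.stk) := by
  have h1 : (toSim S a).1 = .inl ⟨q, hqS⟩ := by simp [toSim, hq, label, hqS]
  have h2 : (toSim S a).2.2.get = a.stk := by
    funext k; cases k <;> rfl
  rw [simStep, h1]
  simp only [h2]
  rfl

/-- The number of steps of the evaluator between two of its configurations, for the loop as well
as for the simulation. -/
theorem exists_steps {q₀ : Λ'} {a b : TM2.Cfg (fun _ : K' => Γ') Λ' (Option Γ')}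
    (hS : ∀ q ∈ S, TM2.SupportsStmt S (tr q))
    (hab : StateTransition.Reaches (TM2.step tr) a b) (ha : a.l ∈ Finset.insertNone S) :
    ∃ n, (∀ i, (flip bind (TM2.step (program S q₀)))^[n] (some (liftCfg S a i)) =
        some (liftCfg S b i)) ∧
      (simStep S)^[n] (toSim S a) = toSim S b ∧
      ∀ m < n, ((simStep S)^[m] (toSim S a)).1 ≠ .inr .loop := by
  induction hab using Relation.ReflTransGen.head_induction_on with
  | refl => exact ⟨0, fun _ => rfl, rfl, fun m hm => absurd hm (Nat.not_lt_zero m)⟩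
  | head hac _ ih =>
    rename_i a c _
    obtain ⟨_ | q, v, T⟩ := a
    · cases hac
    have hqS : q ∈ S := by simpa using ha
    have hc : c.l ∈ Finset.insertNone S :=
      @TM2.step_supports _ _ _ _ ⟨q⟩ _ tr S ⟨hqS, hS⟩ _ _ hac ha
    simp only [TM2.step, Option.mem_def, Option.some.injEq] at hac
    obtain ⟨n, h1, h2, h3⟩ := ih hc
    have hsim := simStep_toSim S (a := ⟨some q, v, T⟩) rfl hqS
    have hac' : TM2.stepAux (tr q) v T = c := hac
    simp only [hac'] at hsim
    refine ⟨n + 1, fun i => ?_, ?_, fun m hm => ?_⟩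
    · rw [iterate_succ_apply, ← h1 i]
      congr 1
      have : liftCfg S ⟨some q, v, T⟩ i = ⟨some (.inl ⟨q, hqS⟩), v, stackFun T i []⟩ := by
        simp [liftCfg, label, hqS]
      rw [this]
      exact congrArg some
        ((stepAux_liftStmt S _ v T i).trans (congrArg (liftCfg S · i) hac'))
    · rw [iterate_succ_apply, hsim, h2]
    · rcases m with _ | m
      · simp [toSim, label, hqS]
      · rw [iterate_succ_apply, hsim]
        exact h3 m (by omega)

end Simulation

end FoldMachine

/-! ### Computability of the evaluator's running time -/

/-- The elements of a finite type are coded in some arbitrary order. -/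
noncomputable abbrev Primcodable.ofFintype (α : Type*) [Fintype α] : Primcodable α :=
  Primcodable.ofEquiv (Fin (Fintype.card α)) (Fintype.equivFin α)

theorem Primrec.of_forall_finite {ι α σ : Type*} [Primcodable ι] [Finite ι] [Primcodable α]
    [Primcodable σ] {f : ι → α → σ} (hf : ∀ i, Primrec (f i)) : Primrec₂ f := by
  obtain ⟨n, ⟨e⟩⟩ := Finite.exists_equiv_fin ι
  have h : Primrec₂ fun (i : Fin n) a => f (e.symm i) a :=
    Primrec.fin_curry₁.2 fun i => hf (e.symm i)
  have h' : Primrec fun y : ι × α => f (e.symm (e y.1)) y.2 :=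
    h.comp ((Primrec.dom_finite e).comp Primrec.fst) Primrec.snd
  exact h'.of_eq fun y => by rw [e.symm_apply_apply]

namespace FoldMachine

open Turing Turing.PartrecToTM2 Turing.ToPartrec Function

noncomputable instance : Primcodable Γ' := Primcodable.ofFintype Γ'

noncomputable instance : Primcodable Control := Primcodable.ofFintype Control

noncomputable instance (S : Finset Λ') : Primcodable S := Primcodable.ofFintype S

theorem primrec_trNat : Primrec trNat := by
  have hhalf : Primrec fun p : Unit × List (List Γ') => p.2.length :=
    Primrec.list_length.comp Primrec.snd
  -- Course-of-values recursion: `l` lists the values below `n`, so its length is `n` and its entry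
  -- at `n.div2` is the numeral without its lowest digit.
  have hg : Primrec₂ fun (_ : Unit) (l : List (List Γ')) =>
      if l.length = 0 then some [] else
        l[l.length.div2]?.map fun t => (bif l.length.bodd then Γ'.bit1 else Γ'.bit0) :: t := by
    refine Primrec.ite (Primrec.eq.comp hhalf (Primrec.const 0)) (Primrec.const _) ?_
    exact Primrec.option_map
      (Primrec.list_getElem?.comp Primrec.snd (Primrec.nat_div2.comp hhalf))
      (Primrec.list_cons.comp (Primrec.cond (Primrec.nat_bodd.comp (hhalf.comp Primrec.fst))
        (Primrec.const _) (Primrec.const _)) Primrec.snd)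
  have := Primrec.nat_strong_rec (fun (_ : Unit) n => trNat n) hg fun _ n => by
    by_cases hn : n = 0
    · simp [hn]
    · have hlt : n.div2 < n := Nat.binaryRec_decreasing hn
      simp [hn, hlt, trNat_eq_cons hn]
  exact this.comp (Primrec.const ()) Primrec.id

theorem primrec_tuple_get (k : K') : Primrec fun t : Tuple => t.get k := by
  cases k
  · exact Primrec.fst.comp Primrec.fst
  · exact Primrec.snd.comp Primrec.fst
  · exact Primrec.fst.comp Primrec.snd
  · exact Primrec.snd.comp Primrec.snd

theorem primrec_tuple_set (k : K') : Primrec₂ fun (t : Tuple) L => t.set k L := by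
  open Primrec in
  cases k
  · exact pair (pair snd (snd.comp (fst.comp fst))) (snd.comp fst)
  · exact pair (pair (fst.comp (fst.comp fst)) snd) (snd.comp fst)
  · exact pair (fst.comp fst) (pair snd (snd.comp (snd.comp fst)))
  · exact pair (fst.comp fst) (pair (fst.comp (snd.comp fst)) snd)

variable (S : Finset Λ')

/-- Every function occurring in a statement has a finite domain and is therefore primitive
recursive; the stacks change only by list operations. -/
theorem primrec_stepAux (q : TM2.Stmt (fun _ : K' => Γ') Λ' (Option Γ')) :
    Primrec fun y : Option Γ' × Tuple => toSim S (TM2.stepAux q y.1 y.2.get) := by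
  open Primrec in
  have hget (k : K') : Primrec fun y : Option Γ' × Tuple => y.2.get k :=
    (primrec_tuple_get k).comp snd
  have hread (f : Option Γ' → Option Γ' → Option Γ') (k : K') :
      Primrec fun y : Option Γ' × Tuple => f y.1 (y.2.get k).head? :=
    (Primrec.dom_finite fun z : Option Γ' × Option Γ' => f z.1 z.2).comp
      (pair fst (list_head?.comp (hget k)))
  induction q with
  | push k f q ih =>
    refine (ih.comp (pair fst ((primrec_tuple_set k).comp snd (list_cons.comp
      ((Primrec.dom_finite f).comp fst) (hget k))))).of_eq fun y => ?_
    rw [TM2.stepAux, Tuple.get_set]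
  | peek k f q ih => exact ih.comp (pair (hread f k) snd)
  | pop k f q ih =>
    refine (ih.comp (pair (hread f k) ((primrec_tuple_set k).comp snd
      (list_tail.comp (hget k))))).of_eq fun y => ?_
    rw [TM2.stepAux, Tuple.get_set]
  | load f q ih => exact ih.comp (pair ((Primrec.dom_finite f).comp fst) snd)
  | branch f q₁ q₂ ih₁ ih₂ =>
    refine (Primrec.cond ((Primrec.dom_finite f).comp fst) ih₁ ih₂).of_eq fun y => ?_
    rw [TM2.stepAux]
    cases f y.1 <;> rfl
  | goto l => exact pair ((Primrec.dom_finite fun v => label S (l v)).comp fst) Primrec.id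
  | halt => exact pair (Primrec.const _) Primrec.id

theorem primrec_simStep : Primrec (simStep S) := by
  have h : Primrec₂ fun (l : S ⊕ Control) (y : Option Γ' × Tuple) => simStep S (l, y) := by
    refine Primrec.of_forall_finite fun l => ?_
    rcases l with q | c
    · exact primrec_stepAux S _
    · exact Primrec.pair (Primrec.const _) Primrec.id
  exact h

/-- The start of an evaluation on the arguments `b` and `s`. -/
def simInit (q₀ : Λ') (b s : ℕ) : (S ⊕ Control) × (Option Γ' × Tuple) :=
  (label S q₀, none, (trList [b, s], []), ([], []))

theorem primrec_simInit (q₀ : Λ') : Primrec₂ (simInit S q₀) := by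
  open Primrec in
  have h : Primrec₂ fun b s : ℕ => trNat b ++ Γ'.cons :: (trNat s ++ [Γ'.cons]) :=
    list_append.comp (primrec_trNat.comp fst) (list_cons.comp (Primrec.const _)
      (list_append.comp (primrec_trNat.comp snd) (Primrec.const _)))
  exact pair (Primrec.const _) (pair (Primrec.const _) (pair (pair h (Primrec.const _))
    (Primrec.const _)))

/-- A computable function is evaluated, in a number of steps that depends computably on the
arguments, by a finite part of the program of the evaluator of partial recursive functions. -/
theorem exists_evaluator {δ : ℕ → ℕ → ℕ} (hδ : Computable₂ δ) :
    ∃ (S : Finset Λ') (q₀ : Λ') (t : ℕ → ℕ → ℕ), Computable₂ t ∧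
      ∀ b s i, (flip bind (TM2.step (program S q₀)))^[t b s]
        (some ⟨some (label S q₀), none, stackFun (K'.elim (trList [b, s]) [] [] []) i []⟩) =
        some ⟨some (.inr .loop), none, stackFun (K'.elim (trList [δ b s]) [] [] []) i []⟩ := by
  obtain ⟨c, hc⟩ := Code.exists_code (Nat.Partrec'.part_iff₂.2 hδ.partrec₂)
  have hcode : ∀ b s : ℕ, c.eval [b, s] = pure [δ b s] := fun b s => by
    refine (hc ⟨[b, s], rfl⟩).trans ?_
    simp only [PFun.coe_val, Part.map_eq_map, Part.map_some]
    rfl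
  set q₀ := trNormal c Cont'.halt
  -- The evaluator has infinitely many labels, but a fixed code reaches only this finite set, as a
  -- machine requires.
  set S := codeSupp c Cont'.halt
  obtain ⟨hq₀S, hS⟩ : q₀ ∈ S ∧ ∀ q ∈ S, TM2.SupportsStmt S (tr q) := tr_supports c Cont'.halt
  have hrun : ∀ b s, ∃ n,
      (∀ i, (flip bind (TM2.step (program S q₀)))^[n]
        (some ⟨some (label S q₀), none, stackFun (K'.elim (trList [b, s]) [] [] []) i []⟩) =
        some ⟨some (.inr .loop), none, stackFun (K'.elim (trList [δ b s]) [] [] []) i []⟩) ∧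
      ((simStep S)^[n] (simInit S q₀ b s)).1 = .inr .loop ∧
      ∀ m < n, ((simStep S)^[m] (simInit S q₀ b s)).1 ≠ .inr .loop := by
    intro b s
    have h1 : PartrecToTM2.halt [δ b s] ∈
        StateTransition.eval (TM2.step tr) (PartrecToTM2.init c [b, s]) := by
      rw [PartrecToTM2.tr_eval, hcode]
      change _ ∈ Part.map PartrecToTM2.halt (Part.some _)
      rw [Part.map_some]
      exact Part.mem_some _
    obtain ⟨n, h2, h3, h4⟩ := exists_steps S (q₀ := q₀) hS (StateTransition.mem_eval.1 h1).1
      (Finset.some_mem_insertNone.2 hq₀S)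
    refine ⟨n, h2, ?_, h4⟩
    have h3' : (simStep S)^[n] (simInit S q₀ b s) = toSim S (PartrecToTM2.halt [δ b s]) := h3
    rw [h3']
    rfl
  choose t ht1 ht2 ht3 using hrun
  refine ⟨S, q₀, t, ?_, ht1⟩
  have hp : Primrec₂ fun (y : ℕ × ℕ) (n : ℕ) =>
      decide (((simStep S)^[n] (simInit S q₀ y.1 y.2)).1 = .inr .loop) := by
    refine (Primrec.eq.comp (Primrec.fst.comp (Primrec.nat_iterate Primrec.snd
      ((primrec_simInit S q₀).comp (Primrec.fst.comp Primrec.fst)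
        (Primrec.snd.comp Primrec.fst)) ?_)) (Primrec.const _)).decide
    exact (primrec_simStep S).comp Primrec.snd
  -- `t` is the first time at which the simulation reaches the head of the loop, so unbounded search
  -- finds exactly this number.
  have hr := Partrec.rfind (p := fun (y : ℕ × ℕ) (n : ℕ) => (Part.some
    (decide (((simStep S)^[n] (simInit S q₀ y.1 y.2)).1 = .inr .loop)) : Part Bool))
    hp.to_comp.partrec
  refine hr.of_eq_tot fun y => Nat.mem_rfind.2 ⟨?_, fun {m} hm => ?_⟩
  · simp [ht2]
  · simpa using ht3 y.1 y.2 m hm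

end FoldMachine

/-! ### Runs of the loop and their length -/

namespace FoldMachine

open Turing Turing.PartrecToTM2 Turing.ToPartrec Function

theorem flip_bind_some {σ : Type*} (f : σ → Option σ) (a : σ) : flip bind f (some a) = f a :=
  rfl

variable (S : Finset Λ') (q₀ : Λ')

/-- The stacks of the loop when only `main` is used by the evaluator. -/
abbrev mainStack (m i : List Γ') (o : List Bool) : ∀ k, List (Alphabet k) :=
  stackFun (K'.elim m [] [] []) i o

theorem update_main (m i : List Γ') (o : List Bool) (L : List Γ') :
    update (mainStack m i o) (.inl .main) L = mainStack L i o := by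
  rw [mainStack, stackFun_update_inl, K'.elim_update_main]

theorem trNat_symbolCode (a : Bool ⊕ Bool) :
    trNat (FinGraph.symbolCode a) = [bitDigit (some (symbolEquiv.symm a)),
      partDigit (some (symbolEquiv.symm a)), Γ'.bit1] := by
  rcases a with (_ | _) | (_ | _) <;> rfl

theorem step_start (i : List Γ') : TM2.step (program S q₀) ⟨some (.inr .start), none, mainStack [] i []⟩ =
    some ⟨some (.inr .loop), none, mainStack (trList [0]) i []⟩ := by
  simp only [program, TM2.step, TM2.stepAux, update_main]
  simp [stackFun]

theorem step_loop_cons (a : Bool ⊕ Bool) (i : List Γ') (s : ℕ) :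
    TM2.step (program S q₀)
      ⟨some (.inr .loop), none, mainStack (trList [s]) (symbolEquiv.symm a :: i) []⟩ =
    some ⟨some (label S q₀), none, mainStack (trList [FinGraph.symbolCode a, s]) i []⟩ := by
  have h : trList [FinGraph.symbolCode a, s] = bitDigit (some (symbolEquiv.symm a)) ::
      partDigit (some (symbolEquiv.symm a)) :: Γ'.bit1 :: Γ'.cons :: trList [s] := by
    rw [trList, trNat_symbolCode]; rfl
  rw [h]
  simp only [program, TM2.step, TM2.stepAux, stackFun_update_input, update_main]
  simp [stackFun]

theorem step_loop_nil (m : List Γ') :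
    TM2.step (program S q₀) ⟨some (.inr .loop), none, mainStack m [] []⟩ =
    some ⟨some (.inr .finish), none, mainStack m [] []⟩ := by
  simp only [program, TM2.step, TM2.stepAux, stackFun_update_input]
  simp [stackFun]

theorem step_finish (m : List Γ') :
    TM2.step (program S q₀) ⟨some (.inr .finish), none, mainStack m [] []⟩ =
    some ⟨some (.inr .clear), none, mainStack m.tail [] [decide (m.head? = some Γ'.bit1)]⟩ := by
  simp only [program, TM2.step, TM2.stepAux, stackFun_update_output, update_main]
  simp [stackFun]

theorem iterate_clear (m : List Γ') (v : Option Γ') (o : List Bool) :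
    (flip bind (TM2.step (program S q₀)))^[m.length + 1]
      (some ⟨some (.inr .clear), v, mainStack m [] o⟩) =
    some ⟨none, none, mainStack [] [] o⟩ := by
  induction m generalizing v with
  | nil =>
    rw [List.length_nil, iterate_succ_apply, iterate_zero_apply, flip_bind_some]
    simp only [program, TM2.step, TM2.stepAux, update_main]
    simp [stackFun]
  | cons x m ih =>
    rw [List.length_cons, iterate_succ_apply, ← ih (some x)]
    congr 1
    rw [flip_bind_some]
    simp only [program, TM2.step, TM2.stepAux, update_main]
    simp [stackFun]

variable {S q₀}

/-- The loop over the input, from its head to the halting configuration. -/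
theorem exists_iterate_loop {δ t : ℕ → ℕ → ℕ}
    (ht : ∀ b s i, (flip bind (TM2.step (program S q₀)))^[t b s]
      (some ⟨some (label S q₀), none, mainStack (trList [b, s]) i []⟩) =
      some ⟨some (.inr .loop), none, mainStack (trList [δ b s]) i []⟩)
    (B : ℕ) (w : List (Bool ⊕ Bool)) (s : ℕ)
    (hB : ∀ u, u <+: w → ∀ a,
      u.foldl (fun s a => δ (FinGraph.symbolCode a) s) s +
        t (FinGraph.symbolCode a) (u.foldl (fun s a => δ (FinGraph.symbolCode a) s) s) ≤ B) :
    ∃ n ≤ (B + 4) * (w.length + 1), (flip bind (TM2.step (program S q₀)))^[n]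
      (some ⟨some (.inr .loop), none, mainStack (trList [s]) (w.map symbolEquiv.symm) []⟩) =
      some ⟨none, none, mainStack [] [] [decide
        (w.foldl (fun s a => δ (FinGraph.symbolCode a) s) s % 2 = 1)]⟩ := by
  induction w generalizing s with
  | nil =>
    -- One step detects the end of the input, one outputs the bit, and clearing `main` takes at most
    -- `s + 1` steps. This is why `B` also bounds the states.
    refine ⟨(trList [s]).tail.length + 1 + 1 + 1, ?_, ?_⟩
    · have h1 := hB [] (List.prefix_refl _) (.inl false)
      have h2 := length_trNat_le s
      have h3 : (trList [s]).length = (trNat s).length + 1 := by simp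
      rw [List.length_tail, h3]
      simp only [List.foldl_nil] at h1
      simp only [List.length_nil]
      omega
    · rw [iterate_succ_apply, iterate_succ_apply, List.map_nil, flip_bind_some, step_loop_nil,
        flip_bind_some, step_finish, iterate_clear, decide_eq_decide.2 (head?_trList_singleton s),
        List.foldl_nil]
  | cons a w ih =>
    obtain ⟨n, hn, hrun⟩ := ih (δ (FinGraph.symbolCode a) s) fun u hu a' => by
      have := hB (a :: u) (by simpa using hu) a'
      simpa using this
    refine ⟨n + t (FinGraph.symbolCode a) s + 1, ?_, ?_⟩
    · have h1 := hB [] (List.nil_prefix) a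
      simp only [List.foldl_nil] at h1
      rw [List.length_cons, Nat.mul_succ]
      omega
    · rw [iterate_succ_apply, iterate_add_apply, List.map_cons, flip_bind_some, step_loop_cons,
        ht, hrun, List.foldl_cons]

/-- The program as a bundled machine. -/
def machine (S : Finset Λ') (q₀ : Λ') : TM2ComputableAux (Bool ⊕ Bool) Bool where
  tm :=
    { K := K' ⊕ Bool
      k₀ := .inr false
      k₁ := .inr true
      Γ := Alphabet
      Λ := S ⊕ Control
      main := .inr .start
      σ := Option Γ'
      initialState := none
      Γk₀Fin := inferInstanceAs (Fintype Γ')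
      m := program S q₀ }
  inputAlphabet := symbolEquiv
  outputAlphabet := Equiv.refl Bool

theorem initList_machine (w : List Γ') :
    initList (machine S q₀).tm w = ⟨some (.inr .start), none, mainStack [] w []⟩ := by
  have : (initList (machine S q₀).tm w).stk = mainStack [] w [] := by
    funext k
    rcases k with (_ | _ | _ | _) | _ | _ <;> rfl
  rw [← this]
  rfl

theorem haltList_machine (o : List Bool) :
    haltList (machine S q₀).tm o = ⟨none, none, mainStack [] [] o⟩ := by
  have : (haltList (machine S q₀).tm o).stk = mainStack [] [] o := by
    funext k
    rcases k with (_ | _ | _ | _) | _ | _ <;> rfl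
  rw [← this]
  rfl

/-- Some machine computes, up to a constant factor in the time that the evaluations of `δ` need,
the parity of the result of folding a computable function `δ` over its input. -/
theorem exists_machine {δ : ℕ → ℕ → ℕ} (hδ : Computable₂ δ) :
    ∃ (M : TM2ComputableAux (Bool ⊕ Bool) Bool) (t : ℕ → ℕ → ℕ), Computable₂ t ∧
      (∀ k, Finite (M.tm.Γ k)) ∧ ∀ (w : List (Bool ⊕ Bool)) (B : ℕ),
        (∀ u, u <+: w → ∀ a, u.foldl (fun s a => δ (FinGraph.symbolCode a) s) 0 +
          t (FinGraph.symbolCode a) (u.foldl (fun s a => δ (FinGraph.symbolCode a) s) 0) ≤ B) →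
        Nonempty (TM2OutputsInTime M.tm (w.map M.inputAlphabet.symm)
          (some ([decide (w.foldl (fun s a => δ (FinGraph.symbolCode a) s) 0 % 2 = 1)].map
            M.outputAlphabet.symm)) ((B + 5) * (w.length + 1))) := by
  obtain ⟨S, q₀, t, htc, ht⟩ := exists_evaluator hδ
  refine ⟨machine S q₀, t, htc, ?_, fun w B hB => ?_⟩
  · rintro (_ | _ | _)
    · exact inferInstanceAs (Finite Γ')
    · exact inferInstanceAs (Finite Γ')
    · exact inferInstanceAs (Finite Bool)
  · obtain ⟨n, hn, hrun⟩ := exists_iterate_loop ht B w 0 hB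
    -- The extra step puts the numeral of the initial state 0 on the stack.
    refine ⟨⟨⟨n + 1, ?_⟩, ?_⟩⟩
    · refine (iterate_succ_apply _ _ _).trans (Eq.trans ?_
        (hrun.trans (congrArg some (haltList_machine _).symm)))
      exact congrArg _ ((congrArg _ (congrArg some (initList_machine _))).trans
        (step_start S q₀ _))
    · change n + 1 ≤ _
      rw [add_mul] at hn ⊢
      omega

end FoldMachine

/-! ### Fixed-parameter tractability -/

theorem theorem5 (𝓕 𝒢 : Set FinGraph)
    (h_decidable : FinGraph.DecidableMembership 𝒢)
    (h_induced : FinGraph.ClosedUnderInducedSubgraphs 𝒢)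
    (h_union : FinGraph.ClosedUnderDisjointUnions 𝒢)
    (h_connected : ∀ F ∈ 𝓕, F.graph.Connected) :
    (pSingleHomRec 𝓕 𝒢).InFPT := by
  obtain ⟨δ, C, hδ, hC, hdec⟩ := FinGraph.exists_transition 𝒢 h_decidable h_induced h_union
  obtain ⟨M, t, ht, hfin, hM⟩ := FoldMachine.exists_machine hδ
  -- Symbol codes are below 8 and states at most `C k`; sums over these ranges serve as computable
  -- upper bounds for the maximal cost of a transition.
  let q : ℕ → ℕ := fun s => s + ∑ b ∈ Finset.range 8, t b s
  let B : ℕ → ℕ := fun k => ∑ s ∈ Finset.range (C k + 1), q s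
  have hq : Computable q := by
    refine Primrec.nat_add.to_comp.comp Computable.id ?_
    exact Computable.sum_range (q := fun s b => t b s) (ht.comp Computable.snd Computable.fst)
      (Computable.const 8)
  have hB : Computable fun k => B k + 5 := by
    refine Primrec.nat_add.to_comp.comp ?_ (Computable.const 5)
    exact Computable.sum_range (q := fun _ s => q s) (hq.comp Computable.snd)
      (Computable.succ.comp hC)
  have hcode : ∀ a, FinGraph.symbolCode a ∈ Finset.range 8 := by
    rintro ((_ | _) | (_ | _)) <;> simp [FinGraph.symbolCode]
  refine ⟨M, fun k => B k + 5, Polynomial.X + 1, hfin, hB, ?_⟩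
  rintro ⟨⟨F, h⟩, hF⟩
  obtain ⟨hbound, hanswer⟩ := hdec F (h_connected F hF) h
  refine ⟨decide ((FinGraph.encodeWithNumber (F, h)).foldl
    (fun s a => δ (FinGraph.symbolCode a) s) 0 % 2 = 1), ?_, ?_⟩
  · rw [decide_eq_true_iff]
    exact hanswer
  · rw [Polynomial.eval_add, Polynomial.eval_X, Polynomial.eval_one]
    refine hM (FinGraph.encodeWithNumber (F, h)) (B F.order) fun u hu a => ?_
    set s := u.foldl (fun s a => δ (FinGraph.symbolCode a) s) 0
    have hs : s ∈ Finset.range (C F.order + 1) :=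
      Finset.mem_range.2 (Nat.lt_succ_of_le (hbound u hu))
    calc s + t (FinGraph.symbolCode a) s ≤ q s := Nat.add_le_add_left
          (Finset.single_le_sum (f := fun b => t b s) (fun _ _ => Nat.zero_le _) (hcode a)) s
      _ ≤ B F.order := Finset.single_le_sum (fun _ _ => Nat.zero_le _) hs
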